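/- For $\alpha\in\mathbb R\setminus\{0,1,2,\dots\}$ and $c>0$ let $$\widehat{\phi_{\alpha,c}}(\xi)=\frac{2^{1+\alpha}}{\Gamma(-\alpha)}\Big(\frac{c}{|\xi|}\Big)^{\alpha+\frac12}K_{\alpha+\frac12}(c|\xi|),\qquad \xi\in\mathbb R\setminus\{0\},$$ be the generalized Fourier transform of the general multiquadric $\phi_{\alpha,c}(x)=(x^2+c^2)^\alpha$, where $K_\nu$ is the modified Bessel function of the second kind, i.e. $K_{-\nu}=K_\nu$ and $K_\nu(r)=\frac{\Gamma(1/2)\,r^\nu}{2^\nu\Gamma(\nu+1/2)}\int_1^\infty e^{-ru}(u^2-1)^{\nu-1/2}\,du$ for $\nu\ge 0$, $r>0$. Put $$\widehat{L_{\alpha,c}}(\xi)=\frac{\widehat{\phi_{\alpha,c}}(\xi)}{\sum_{j\in\mathbb Z}\widehat{\phi_{\alpha,c}}(\xi+2\pi j)},\qquad L_{\alpha,c}(x)=\frac1{2\pi}\int_{\mathbb R}\widehat{L_{\alpha,c}}(\xi)e^{ix\xi}\,d\xi,$$ and, for a function $f$ on $\mathbb R$ for which the series converges, $$I_{\alpha,c}f(x)=\sum_{j\in\mathbb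 Z}f(j)L_{\alpha,c}(x-j),\qquad x\in\mathbb R.$$ **Theorem.** Let either $\alpha\in[1/2,\infty)\setminus\mathbb N$ and $k\in\{0,1,\dots,\lfloor 2\alpha+1\rfloor-2\}$, or $\alpha\in(-\infty,-3/2)$ and $k\in\{0,1,\dots,\lceil 2|\alpha|-2\rceil-2\}$. Let $0<\varepsilon<1$, let $\mu$ be a $2\pi$-periodic complex Borel measure on $\mathbb R$ (that is, a complex Borel measure on the circle $\mathbb R/2\pi\mathbb Z$) with $$\operatorname{supp}(\mu)\cap[-\pi,\pi)\subset[-\pi(1-\varepsilon),\pi(1-\varepsilon)],$$ and let $$f(x)=(ix)^k\int_{-\pi}^{\pi}e^{-ixt}\,d\mu(t),\qquad x\in\mathbb R.$$ Then, for every $c>0$ and $x\in\mathbb R$, the series defining $I_{\alpha,c}f(x)$ converges absolutely, and $$\lim_{c\to\infty}I_{\alpha,c}f(x)=f(x),\qquad x\in\mathbb R,$$ with convergence being uniform on compact subsets of $\mathbb R$. If $k=0$, the convergence is uniform on $\mathbb R$. -/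

import Mathlib

open MeasureTheory Filter Topology

noncomputable section

namespace Multiquadric

/-- The modified Bessel function of the second kind `K_ν(r)`, `r > 0`: for `ν ≥ 0`,
`K_ν(r) = Γ(1/2) r^ν / (2^ν Γ(ν + 1/2)) ∫_1^∞ e^{-ru} (u² - 1)^{ν - 1/2} du`,
and `K_{-ν} = K_ν`. -/
def besselK (ν r : ℝ) : ℝ :=
  Real.Gamma (1 / 2) * r ^ |ν| / ((2 : ℝ) ^ |ν| * Real.Gamma (|ν| + 1 / 2)) *
    ∫ u in Set.Ioi (1 : ℝ), Real.exp (-(r * u)) * (u ^ 2 - 1) ^ (|ν| - 1 / 2)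

/-- The generalized Fourier transform, on `ℝ \ {0}`, of the general multiquadric
`φ_{α,c}(x) = (x² + c²)^α` (for `α` not a nonnegative integer, `c > 0`):
`2^{1+α} / Γ(-α) * (c / |ξ|)^{α + 1/2} * K_{α + 1/2}(c |ξ|)`. -/
def phiHat (α c ξ : ℝ) : ℝ :=
  (2 : ℝ) ^ (1 + α) / Real.Gamma (-α) * (c / |ξ|) ^ (α + 1 / 2) *
    besselK (α + 1 / 2) (c * |ξ|)

/-- The Fourier transform of the fundamental function: `φ̂(ξ) / ∑_{j ∈ ℤ} φ̂(ξ + 2πj)`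
(meaningful off the null set `2πℤ`). -/
def LHat (α c ξ : ℝ) : ℝ :=
  phiHat α c ξ / ∑' j : ℤ, phiHat α c (ξ + 2 * Real.pi * (j : ℝ))

/-- The fundamental function `L_{α,c}(x) = (2π)⁻¹ ∫_ℝ L̂_{α,c}(ξ) e^{ixξ} dξ`. -/
def fundamental (α c x : ℝ) : ℂ :=
  ((2 * Real.pi : ℝ) : ℂ)⁻¹ *
    ∫ ξ : ℝ, (LHat α c ξ : ℂ) * Complex.exp (Complex.I * (x : ℂ) * (ξ : ℂ))

/-- The cardinal interpolant `I_{α,c} f(x) = ∑_{j ∈ ℤ} f(j) L_{α,c}(x - j)`. -/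
def interpolant (α c : ℝ) (f : ℝ → ℂ) (x : ℝ) : ℂ :=
  ∑' j : ℤ, f (j : ℝ) * fundamental α c (x - (j : ℝ))

/-- The circle `ℝ / 2πℤ`. A `2π`-periodic complex Borel measure on the real line (an element of
`M(𝕋)`) is a complex Borel measure on it. -/
abbrev Circ : Type := AddCircle (2 * Real.pi)

/-- The representative of a point of the circle in the period `[-π, π)`. -/
def rep (z : Circ) : ℝ :=
  (QuotientAddGroup.equivIcoMod Real.two_pi_pos (-Real.pi) z : ℝ)

/-- The integral `∫_{-π}^{π} g dμ` over the period `[-π, π)`, for `μ` in `M(𝕋)`. -/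
def periodIntegral (μ : ComplexMeasure Circ) (g : ℝ → ℂ) : ℂ :=
  VectorMeasure.integral μ (fun z => g (rep z)) (ContinuousLinearMap.mul ℝ ℂ)

/-- The function `f(x) = (ix)^k ∫_{-π}^{π} e^{-ixt} dμ(t)`. -/
def measureTransform (k : ℕ) (μ : ComplexMeasure Circ) (x : ℝ) : ℂ :=
  (Complex.I * (x : ℂ)) ^ k *
    periodIntegral μ (fun t => Complex.exp (-(Complex.I * (x : ℂ) * (t : ℂ))))

/-- The admissible pairs `(α, k)`: either `α ∈ [1/2, ∞) \ ℕ` and `0 ≤ k ≤ ⌊2α + 1⌋ - 2`, or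
`α < -3/2` and `0 ≤ k ≤ ⌈2|α| - 2⌉ - 2`. -/
def Admissible (α : ℝ) (k : ℕ) : Prop :=
  (1 / 2 ≤ α ∧ (∀ n : ℕ, α ≠ (n : ℝ)) ∧ (k : ℤ) ≤ ⌊2 * α + 1⌋ - 2) ∨
    (α < -(3 / 2) ∧ (k : ℤ) ≤ ⌈2 * |α| - 2⌉ - 2)

end Multiquadric

end

/-! Up to a constant, the transform of the multiquadric is `|ξ|^(-p) * kernel a (c ξ)`, where
`kernel a` is even, equals `e^{-|t|}` up to polynomial factors, and has as many controlled
derivatives as `2a` allows (`exists_phiHat_eq`, `smoothBdd_kernel`, `le_kernel`). Put `ξ = 2πs`, `κ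
= 2πc`. The function `|sin πs|^p` has period 1, so multiplying numerator and denominator of the
quotient by it changes nothing and removes the singularities: the quotient becomes `psi / psiSum`
(`LHat_eq`).

By Poisson summation the numbers `L(x - m)` are the Fourier coefficients of the 1-periodic function
`periodized`, which is `e^{2πixs}(1 + errorTerm)` (`perCoeff_periodized`, `tsum_modulated`,
`fundamental_eq_perCoeff`). It is `C^{k+1}`, so the Fourier series of its `k`-th derivative
converges absolutely; evaluated at `s = -t/(2π)` and integrated against `μ`, this series is `(2π)^k`
times the interpolation series (`hasSum_interpolant`). The same operation on `e^{2πixs}` alone gives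
`(2π)^k f(x)`. The interpolation error is therefore controlled by the `k`-th derivative of
`e^{2πixs} * errorTerm` on `|s| ≤ (1 - ε)/2`, the image of the band containing the support of `μ`.

There the error is exponentially small (`smoothBdd_errorTerm`). The `m = 0` term cancels in its
numerator, which is then of size `e^{-κ(1-|s|)}`, while the denominator is at least a constant times
`e^{-κ|s|}`. The ratio is `e^{-κ(1-2|s|)} ≤ e^{-κε}`, and derivatives cost only powers of `κ`.
Differentiating the modulation costs powers of `|x|`, hence uniformity on compact sets; for `k = 0`
no such power occurs, hence uniformity on the line.

The calculus `SmoothBdd` carries these estimates through products, inverses, powers and series,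
uniformly in `κ` and `x`. -/

noncomputable section

namespace Multiquadric

/-! ### Calculus of weighted derivative bounds, uniform in an index -/

section SmoothBdd

variable {ι ι' 𝕜 : Type*} [RCLike 𝕜]

/-- `‖f i t‖ ≤ C * ρ i t ^ M * W i t` on `S`, for some `C`, `M` uniform in the index. -/
def PolyBdd (S : Set ℝ) (ρ W : ι → ℝ → ℝ) (f : ι → ℝ → 𝕜) : Prop :=
  ∃ C : ℝ, ∃ M : ℕ, 0 ≤ C ∧ ∀ i, ∀ t ∈ S, ‖f i t‖ ≤ C * ρ i t ^ M * W i t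

/-- A family of `C^n` functions all of whose derivatives up to order `n` are bounded on `S` by
the weight `W`, up to constants and powers of `ρ`. -/
def SmoothBdd (S : Set ℝ) (ρ W : ι → ℝ → ℝ) : ℕ → (ι → ℝ → 𝕜) → Prop
  | 0, f => (∀ i, Continuous (f i)) ∧ PolyBdd S ρ W f
  | n + 1, f => PolyBdd S ρ W f ∧
      ∃ g : ι → ℝ → 𝕜, (∀ i t, HasDerivAt (f i) (g i t) t) ∧ SmoothBdd S ρ W n g

variable {S : Set ℝ} {ρ W W₁ W₂ : ι → ℝ → ℝ} {n : ℕ}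

lemma PolyBdd.add (hρ : ∀ i t, 1 ≤ ρ i t) (hW : ∀ i t, 0 ≤ W i t) {f g : ι → ℝ → 𝕜}
    (hf : PolyBdd S ρ W f) (hg : PolyBdd S ρ W g) : PolyBdd S ρ W (fun i t => f i t + g i t) := by
  obtain ⟨C, M, hC, hf⟩ := hf
  obtain ⟨C', M', hC', hg⟩ := hg
  refine ⟨C + C', M + M', by positivity, fun i t ht => (norm_add_le _ _).trans ?_⟩
  have h0 := hW i t
  have h1 := hρ i t
  calc _ ≤ C * ρ i t ^ M * W i t + C' * ρ i t ^ M' * W i t := add_le_add (hf i t ht) (hg i t ht)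
    _ ≤ C * ρ i t ^ (M + M') * W i t + C' * ρ i t ^ (M + M') * W i t := by
      gcongr <;> first | assumption | omega
    _ = _ := by ring

lemma PolyBdd.mul (hρ : ∀ i t, 1 ≤ ρ i t) (hW₁ : ∀ i t, 0 ≤ W₁ i t) {f g : ι → ℝ → 𝕜}
    (hf : PolyBdd S ρ W₁ f) (hg : PolyBdd S ρ W₂ g) :
    PolyBdd S ρ (fun i t => W₁ i t * W₂ i t) (fun i t => f i t * g i t) := by
  obtain ⟨C, M, hC, hf⟩ := hf
  obtain ⟨C', M', hC', hg⟩ := hg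
  refine ⟨C * C', M + M', by positivity, fun i t ht => ?_⟩
  have h0 := hW₁ i t
  have h1 := zero_le_one.trans (hρ i t)
  rw [norm_mul]
  calc _ ≤ (C * ρ i t ^ M * W₁ i t) * (C' * ρ i t ^ M' * W₂ i t) :=
        mul_le_mul (hf i t ht) (hg i t ht) (norm_nonneg _) (by positivity)
    _ = _ := by ring

lemma SmoothBdd.polyBdd {f : ι → ℝ → 𝕜} (hf : SmoothBdd S ρ W n f) : PolyBdd S ρ W f := by
  cases n with
  | zero => exact hf.2
  | succ n => exact hf.1

lemma SmoothBdd.continuous {f : ι → ℝ → 𝕜} (hf : SmoothBdd S ρ W n f) (i : ι) :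
    Continuous (f i) := by
  cases n with
  | zero => exact hf.1 i
  | succ n =>
    obtain ⟨-, g, hg, -⟩ := hf
    exact continuous_iff_continuousAt.2 fun t => (hg i t).continuousAt

lemma SmoothBdd.of_succ {f : ι → ℝ → 𝕜} (hf : SmoothBdd S ρ W (n + 1) f) :
    SmoothBdd S ρ W n f := by
  induction n generalizing f with
  | zero => exact ⟨hf.continuous, hf.1⟩
  | succ n ih =>
    obtain ⟨h, g, hg, hgn⟩ := hf
    exact ⟨h, g, hg, ih hgn⟩

lemma SmoothBdd.add (hρ : ∀ i t, 1 ≤ ρ i t) (hW : ∀ i t, 0 ≤ W i t) {f g : ι → ℝ → 𝕜}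
    (hf : SmoothBdd S ρ W n f) (hg : SmoothBdd S ρ W n g) :
    SmoothBdd S ρ W n (fun i t => f i t + g i t) := by
  induction n generalizing f g with
  | zero => exact ⟨fun i => (hf.1 i).add (hg.1 i), hf.2.add hρ hW hg.2⟩
  | succ n ih =>
    obtain ⟨h, f', hf', hfn⟩ := hf
    obtain ⟨h₁, g', hg', hgn⟩ := hg
    exact ⟨h.add hρ hW h₁, _, fun i t => (hf' i t).add (hg' i t), ih hfn hgn⟩

lemma SmoothBdd.mul (hρ : ∀ i t, 1 ≤ ρ i t) (hW₁ : ∀ i t, 0 ≤ W₁ i t) (hW₂ : ∀ i t, 0 ≤ W₂ i t)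
    {f g : ι → ℝ → 𝕜} (hf : SmoothBdd S ρ W₁ n f) (hg : SmoothBdd S ρ W₂ n g) :
    SmoothBdd S ρ (fun i t => W₁ i t * W₂ i t) n (fun i t => f i t * g i t) := by
  induction n generalizing f g with
  | zero => exact ⟨fun i => (hf.1 i).mul (hg.1 i), hf.2.mul hρ hW₁ hg.2⟩
  | succ n ih =>
    have hf0 := hf.of_succ
    have hg0 := hg.of_succ
    obtain ⟨h, f', hf', hfn⟩ := hf
    obtain ⟨h₁, g', hg', hgn⟩ := hg
    exact ⟨h.mul hρ hW₁ h₁, _, fun i t => (hf' i t).mul (hg' i t),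
      (ih hfn hg0).add hρ (fun i t => mul_nonneg (hW₁ i t) (hW₂ i t)) (ih hf0 hgn)⟩

lemma SmoothBdd.congr {f : ι → ℝ → 𝕜} (hf : SmoothBdd S ρ W₁ n f)
    (h : ∀ i t, W₁ i t = W₂ i t) : SmoothBdd S ρ W₂ n f := by
  have : W₁ = W₂ := funext₂ h
  rwa [← this]

/-- Affine substitutions and multiplication by constants. -/
lemma SmoothBdd.comp_affine {S' : Set ℝ} {ρ' W' : ι' → ℝ → ℝ} {f : ι → ℝ → 𝕜}
    (hf : SmoothBdd S ρ W n f) (e : ι' → ι) (a b V : ι' → ℝ)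
    (hS : ∀ i, ∀ t ∈ S', a i * t + b i ∈ S) (hρ' : ∀ i t, 1 ≤ ρ' i t)
    (hV : ∀ i, 0 ≤ V i)
    (ha : ∃ C N, 0 ≤ C ∧ ∀ i, ∀ t ∈ S', |a i| ≤ C * ρ' i t ^ N)
    (hW : ∀ M : ℕ, ∃ C, ∃ M' : ℕ, 0 ≤ C ∧ ∀ i, ∀ t ∈ S',
      ρ (e i) (a i * t + b i) ^ M * W (e i) (a i * t + b i) * V i ≤ C * ρ' i t ^ M' * W' i t)
    (q : ι' → 𝕜) (hq : ∃ C, ∃ N : ℕ, 0 ≤ C ∧ ∀ i, ∀ t ∈ S', ‖q i‖ ≤ C * ρ' i t ^ N * V i) :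
    SmoothBdd S' ρ' W' n (fun i t => q i * f (e i) (a i * t + b i)) := by
  have key : ∀ {f : ι → ℝ → 𝕜}, PolyBdd S ρ W f → ∀ q : ι' → 𝕜,
      (∃ C, ∃ N : ℕ, 0 ≤ C ∧ ∀ i, ∀ t ∈ S', ‖q i‖ ≤ C * ρ' i t ^ N * V i) →
      PolyBdd S' ρ' W' (fun i t => q i * f (e i) (a i * t + b i)) := by
    rintro f ⟨C, M, hC, hf⟩ q ⟨C₁, N, hC₁, hq⟩
    obtain ⟨C₂, M', hC₂, hW⟩ := hW M
    refine ⟨C₁ * C * C₂, N + M', by positivity, fun i t ht => ?_⟩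
    have h1 := zero_le_one.trans (hρ' i t)
    have h2 := hV i
    rw [norm_mul]
    calc _ ≤ (C₁ * ρ' i t ^ N * V i) * (C * ρ (e i) (a i * t + b i) ^ M *
          W (e i) (a i * t + b i)) :=
          mul_le_mul (hq i t ht) (hf _ _ (hS i t ht)) (norm_nonneg _) (by positivity)
      _ = C₁ * ρ' i t ^ N * C * (ρ (e i) (a i * t + b i) ^ M *
          W (e i) (a i * t + b i) * V i) := by ring
      _ ≤ C₁ * ρ' i t ^ N * C * (C₂ * ρ' i t ^ M' * W' i t) := by
          exact mul_le_mul_of_nonneg_left (hW i t ht) (by positivity)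
      _ = _ := by ring
  induction n generalizing f q with
  | zero =>
    refine ⟨fun i => continuous_const.mul ((hf.1 _).comp (by fun_prop)), key hf.2 q hq⟩
  | succ n ih =>
    obtain ⟨h, g, hg, hgn⟩ := hf
    -- The chain-rule factor `a i` is absorbed into the multiplier `q`, so the induction hypothesis
    -- applies to the derivative in the same form.
    refine ⟨key h q hq, fun i t => (q i * (a i : 𝕜)) * g (e i) (a i * t + b i), fun i t => ?_,
      ih hgn _ ?_⟩
    · have h1 : HasDerivAt (fun t : ℝ => a i * t + b i) (a i) t := by
        simpa using ((hasDerivAt_id t).const_mul (a i)).add_const (b i)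
      have h2 := ((hg (e i) (a i * t + b i)).scomp t h1).const_mul (q i)
      refine h2.congr_deriv ?_
      rw [RCLike.real_smul_eq_coe_mul]
      ring
    · obtain ⟨C, N, hC, ha⟩ := ha
      obtain ⟨C₁, N₁, hC₁, hq⟩ := hq
      refine ⟨C * C₁, N + N₁, by positivity, fun i t ht => ?_⟩
      have h1 := zero_le_one.trans (hρ' i t)
      have h2 := hV i
      rw [norm_mul, RCLike.norm_ofReal]
      calc _ ≤ (C₁ * ρ' i t ^ N₁ * V i) * (C * ρ' i t ^ N) :=
            mul_le_mul (hq i t ht) (ha i t ht) (abs_nonneg _) (by positivity)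
        _ = _ := by ring

/-- Change of set and of weights. -/
lemma SmoothBdd.weaken {S' : Set ℝ} {ρ' W' : ι → ℝ → ℝ} {f : ι → ℝ → 𝕜}
    (hf : SmoothBdd S ρ W n f) (hS : S' ⊆ S) (hρ' : ∀ i t, 1 ≤ ρ' i t)
    (hW : ∀ M : ℕ, ∃ C, ∃ M' : ℕ, 0 ≤ C ∧ ∀ i, ∀ t ∈ S',
      ρ i t ^ M * W i t ≤ C * ρ' i t ^ M' * W' i t) :
    SmoothBdd S' ρ' W' n f := by
  have := hf.comp_affine (S' := S') (ρ' := ρ') (W' := W') id (fun _ => 1) (fun _ => 0)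
    (fun _ => 1) (by simpa using fun _ t ht => hS ht) hρ' (fun _ => zero_le_one)
    ⟨1, 0, by simp⟩ (by simpa using hW) (fun _ => 1) ⟨1, 0, by simp⟩
  simpa using this

lemma SmoothBdd.const_mul {f : ι → ℝ → 𝕜} (hρ : ∀ i t, 1 ≤ ρ i t) (q : 𝕜)
    (hf : SmoothBdd S ρ W n f) : SmoothBdd S ρ W n (fun i t => q * f i t) := by
  have := hf.comp_affine (S' := S) (ρ' := ρ) (W' := W) id (fun _ => 1) (fun _ => 0)
    (fun _ => 1) (by simp) hρ (fun _ => zero_le_one)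
    ⟨1, 0, by simp⟩ (fun M => ⟨1, M, by simp⟩) (fun _ => q) ⟨‖q‖, 0, by simp⟩
  simpa using this

lemma smoothBdd_const (q : 𝕜) :
    SmoothBdd S ρ (fun _ _ => 1) n (fun (_ : ι) (_ : ℝ) => q) := by
  induction n generalizing q with
  | zero => exact ⟨fun i => continuous_const, ‖q‖, 0, by simp⟩
  | succ n ih => exact ⟨⟨‖q‖, 0, by simp⟩, _, fun i t => hasDerivAt_const t q, ih 0⟩

/-- The derivative `-f' f⁻²` has weight `W * W⁻¹ * W⁻¹ = W⁻¹`, so the class reproduces itself. The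
lower bound on `f` is needed on `S` only, but nonvanishing is needed everywhere because derivatives
exist on the whole line. -/
lemma SmoothBdd.inv (hρ : ∀ i t, 1 ≤ ρ i t) (hW : ∀ i t, 0 < W i t)
    {f : ι → ℝ → 𝕜} (hf : SmoothBdd S ρ W n f) (h0 : ∀ i t, f i t ≠ 0)
    (hl : ∃ C, ∃ M : ℕ, 0 ≤ C ∧ ∀ i, ∀ t ∈ S, W i t ≤ C * ρ i t ^ M * ‖f i t‖) :
    SmoothBdd S ρ (fun i t => (W i t)⁻¹) n (fun i t => (f i t)⁻¹) := by
  have key : PolyBdd S ρ (fun i t => (W i t)⁻¹) (fun i t => (f i t)⁻¹) := by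
    obtain ⟨C, M, hC, hl⟩ := hl
    refine ⟨C, M, hC, fun i t ht => ?_⟩
    have h1 := norm_pos_iff.2 (h0 i t)
    rw [norm_inv, ← div_eq_mul_inv, le_div_iff₀ (hW i t), inv_mul_le_iff₀ h1, mul_comm ‖f i t‖]
    exact hl i t ht
  induction n with
  | zero => exact ⟨fun i => (hf.1 i).inv₀ (h0 i), key⟩
  | succ n ih =>
    have hf0 := ih hf.of_succ
    obtain ⟨h, f', hf', hfn⟩ := hf
    have hW' : ∀ i t, 0 ≤ (W i t)⁻¹ := fun i t => (inv_pos.2 (hW i t)).le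
    refine ⟨key, fun i t => -1 * (f' i t * ((f i t)⁻¹ * (f i t)⁻¹)), fun i t => ?_, ?_⟩
    · convert (hf' i t).fun_inv (h0 i t) using 1
      have := h0 i t
      field_simp
    · refine ((hfn.mul hρ (fun i t => (hW i t).le) (fun i t => mul_nonneg (hW' i t) (hW' i t))
        (hf0.mul hρ hW' hW' hf0)).congr fun i t => ?_).const_mul hρ (-1)
      have := (hW i t).ne'
      field_simp

lemma SmoothBdd.ofReal {f : ι → ℝ → ℝ} (hf : SmoothBdd S ρ W n f) :
    SmoothBdd S ρ W n (fun i t => (f i t : ℂ)) := by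
  have key : ∀ f : ι → ℝ → ℝ, PolyBdd S ρ W f → PolyBdd S ρ W (fun i t => (f i t : ℂ)) := by
    rintro f ⟨C, M, hC, hf⟩
    exact ⟨C, M, hC, fun i t ht => by simpa using hf i t ht⟩
  induction n generalizing f with
  | zero => exact ⟨fun i => Complex.continuous_ofReal.comp (hf.1 i), key _ hf.2⟩
  | succ n ih =>
    obtain ⟨h, f', hf', hfn⟩ := hf
    exact ⟨key _ h, _, fun i t => (hf' i t).ofReal_comp, ih hfn⟩

lemma hasDerivAt_mul_abs_rpow {p : ℝ} (hp : 1 < p) (x : ℝ) :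
    HasDerivAt (fun x : ℝ => x * |x| ^ (p - 1)) (p * |x| ^ (p - 1)) x := by
  have hc : Continuous fun x : ℝ => |x| ^ (p - 1) :=
    continuous_abs.rpow_const fun _ => Or.inr (by linarith)
  have hne : ∀ y : ℝ, y ≠ 0 →
      HasDerivAt (fun x : ℝ => x * |x| ^ (p - 1)) (p * |y| ^ (p - 1)) y := by
    intro y hy
    have h1 : HasDerivAt (fun x : ℝ => |x| ^ (p - 1)) _ y :=
      (hasDerivAt_abs hy).rpow_const (Or.inl (abs_ne_zero.2 hy))
    refine ((hasDerivAt_id y).mul h1).congr_deriv ?_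
    have h2 : |y| ^ (p - 1) = |y| ^ (p - 1 - 1) * |y| := by
      rw [← Real.rpow_add_one (abs_ne_zero.2 hy)]; ring_nf
    have h3 : y * ((SignType.sign y : SignType) : ℝ) = |y| := by
      rw [mul_comm]; exact sign_mul_self y
    simp only [id]
    rw [h2]
    linear_combination ((p - 1) * |y| ^ (p - 1 - 1)) * h3
  rcases eq_or_ne x 0 with rfl | hx
  · exact hasDerivAt_of_hasDerivAt_of_ne (g := fun y => p * |y| ^ (p - 1)) hne
      (continuous_id.mul hc).continuousAt (continuous_const.mul hc).continuousAt
  · exact hne x hx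

lemma abs_mul_abs_rpow {p : ℝ} (hp : 0 < p) (x : ℝ) : |x * |x| ^ (p - 1)| = |x| ^ p := by
  rcases eq_or_ne x 0 with rfl | hx
  · simp [Real.zero_rpow hp.ne']
  · rw [abs_mul, abs_of_nonneg (Real.rpow_nonneg (abs_nonneg x) _), mul_comm,
      ← Real.rpow_add_one (abs_ne_zero.2 hx)]
    ring_nf

lemma continuous_mul_abs_rpow {p : ℝ} (hp : 0 < p) :
    Continuous fun x : ℝ => x * |x| ^ (p - 1) := by
  refine continuous_iff_continuousAt.2 fun x => ?_
  rcases eq_or_ne x 0 with rfl | hx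
  · have h : Tendsto (fun x : ℝ => |x| ^ p) (𝓝 0) (𝓝 0) := by
      have := (continuous_abs.rpow_const (p := p) fun _ => Or.inr hp.le).tendsto (0 : ℝ)
      simpa [Real.zero_rpow hp.ne'] using this
    rw [ContinuousAt, zero_mul, tendsto_zero_iff_abs_tendsto_zero]
    exact h.congr fun x => (abs_mul_abs_rpow hp x).symm
  · exact continuousAt_id.mul (continuous_abs.continuousAt.rpow_const (Or.inl (abs_ne_zero.2 hx)))

/-- The even power `|f|^p` and the odd power `f |f|^(p-1)` are treated together because
differentiation exchanges them while lowering `p` by one. At zeros of `f` this is possible `n` times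
when `n < p`. -/
lemma SmoothBdd.abs_rpow (hρ : ∀ i t, 1 ≤ ρ i t) {f : ι → ℝ → ℝ}
    (hf : SmoothBdd S ρ (fun _ _ => 1) n f) {p : ℝ} (hp : (n : ℝ) < p) :
    SmoothBdd S ρ (fun _ _ => 1) n (fun i t => |f i t| ^ p) ∧
    SmoothBdd S ρ (fun _ _ => 1) n (fun i t => f i t * |f i t| ^ (p - 1)) := by
  have key : ∀ p : ℝ, 0 < p → PolyBdd S ρ (fun _ _ => 1) (fun i t => |f i t| ^ p) := by
    intro p hp
    obtain ⟨C, M, hC, h⟩ := hf.polyBdd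
    -- Only natural powers of `ρ` are allowed, so `p` is rounded up; this requires a base at least
    -- 1, whence `C + 1`.
    refine ⟨(C + 1) ^ ⌈p⌉₊, M * ⌈p⌉₊, by positivity, fun i t ht => ?_⟩
    have h1 := one_le_pow₀ (hρ i t) (n := M)
    have h2 : |f i t| ≤ (C + 1) * ρ i t ^ M := by
      have := h i t ht
      rw [Real.norm_eq_abs] at this
      nlinarith
    have h3 : 1 ≤ (C + 1) * ρ i t ^ M := by nlinarith
    rw [Real.norm_eq_abs, abs_of_nonneg (Real.rpow_nonneg (abs_nonneg _) _), mul_one, pow_mul,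
      ← mul_pow, ← Real.rpow_natCast]
    exact (Real.rpow_le_rpow (abs_nonneg _) h2 hp.le).trans
      (Real.rpow_le_rpow_of_exponent_le h3 (Nat.le_ceil p))
  have key' : ∀ p : ℝ, 0 < p →
      PolyBdd S ρ (fun _ _ => 1) (fun i t => f i t * |f i t| ^ (p - 1)) := by
    intro p hp
    obtain ⟨C, M, hC, h⟩ := key p hp
    refine ⟨C, M, hC, fun i t ht => le_of_eq_of_le ?_ (h i t ht)⟩
    rw [Real.norm_eq_abs, abs_mul_abs_rpow hp, Real.norm_eq_abs,
      abs_of_nonneg (Real.rpow_nonneg (abs_nonneg _) _)]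
  have hp0 : 0 < p := (Nat.cast_nonneg n).trans_lt hp
  induction n generalizing p with
  | zero =>
    exact ⟨⟨fun i => (hf.1 i).abs.rpow_const fun _ => Or.inr hp0.le, key p hp0⟩,
      ⟨fun i => (continuous_mul_abs_rpow hp0).comp (hf.1 i), key' p hp0⟩⟩
  | succ n ih =>
    push_cast at hp
    have hp1 : 1 < p := by linarith [(Nat.cast_nonneg n : (0 : ℝ) ≤ n)]
    have ih' := ih hf.of_succ (p := p - 1) (by linarith) (by linarith)
    obtain ⟨h, f', hf', hfn⟩ := hf
    have one : ∀ (i : ι) (t : ℝ), (0 : ℝ) ≤ 1 := fun _ _ => zero_le_one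
    refine ⟨⟨key p hp0, fun i t => p * (f i t * |f i t| ^ (p - 1 - 1) * f' i t), fun i t => ?_,
      ((ih'.2.mul hρ one one hfn).congr (by simp)).const_mul hρ p⟩,
      ⟨key' p hp0, fun i t => p * (|f i t| ^ (p - 1) * f' i t), fun i t => ?_,
      ((ih'.1.mul hρ one one hfn).congr (by simp)).const_mul hρ p⟩⟩
    · refine ((hasDerivAt_abs_rpow (f i t) hp1).comp t (hf' i t)).congr_deriv ?_
      ring_nf
    · refine ((hasDerivAt_mul_abs_rpow hp1 (f i t)).comp t (hf' i t)).congr_deriv ?_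
      ring_nf

/-- Two majorants play different roles: `hloc`, which may depend on the index, justifies termwise
differentiation near every point, while `hglob` gives the bound on `S` uniformly in the index. -/
lemma SmoothBdd.tsum {ρ W : ι × ℤ → ℝ → ℝ} {ρ' W' : ι → ℝ → ℝ} {f : ι × ℤ → ℝ → 𝕜}
    (hf : SmoothBdd Set.univ ρ W n f)
    (hloc : ∀ (M : ℕ) (i : ι) (R : ℝ), ∃ u : ℤ → ℝ, Summable u ∧
      ∀ m, ∀ t ∈ Metric.ball (0 : ℝ) R, ρ (i, m) t ^ M * W (i, m) t ≤ u m)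
    (hglob : ∀ M : ℕ, ∃ C, ∃ M' : ℕ, 0 ≤ C ∧ ∀ i, ∀ t ∈ S, ∃ u : ℤ → ℝ,
      (∀ m, ρ (i, m) t ^ M * W (i, m) t ≤ u m) ∧ Summable u ∧
      ∑' m, u m ≤ C * ρ' i t ^ M' * W' i t) :
    SmoothBdd S ρ' W' n (fun i t => ∑' m, f (i, m) t) := by
  have loc : ∀ {f : ι × ℤ → ℝ → 𝕜}, PolyBdd Set.univ ρ W f → ∀ i R, ∃ u : ℤ → ℝ, Summable u ∧
      ∀ m, ∀ t ∈ Metric.ball (0 : ℝ) R, ‖f (i, m) t‖ ≤ u m := by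
    rintro f ⟨C, M, hC, h⟩ i R
    obtain ⟨u, hu, hle⟩ := hloc M i R
    refine ⟨fun m => C * u m, hu.mul_left C, fun m t ht => (h _ t trivial).trans ?_⟩
    rw [mul_assoc]
    exact mul_le_mul_of_nonneg_left (hle m t ht) hC
  have glob : ∀ {f : ι × ℤ → ℝ → 𝕜}, PolyBdd Set.univ ρ W f →
      PolyBdd S ρ' W' (fun i t => ∑' m, f (i, m) t) := by
    rintro f ⟨C, M, hC, h⟩
    obtain ⟨C', M', hC', h'⟩ := hglob M
    refine ⟨C * C', M', by positivity, fun i t ht => ?_⟩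
    obtain ⟨u, hle, hu, hsum⟩ := h' i t ht
    refine (tsum_of_norm_bounded (hu.mul_left C).hasSum fun m => (h _ t trivial).trans ?_).trans ?_
    · rw [mul_assoc]
      exact mul_le_mul_of_nonneg_left (hle m) hC
    · rw [tsum_mul_left]
      calc _ ≤ C * (C' * ρ' i t ^ M' * W' i t) := by gcongr
        _ = _ := by ring
  have mem : ∀ t : ℝ, t ∈ Metric.ball (0 : ℝ) (|t| + 1) := fun t => by simp
  induction n generalizing f with
  | zero =>
    refine ⟨fun i => continuous_iff_continuousAt.2 fun t => ?_, glob hf.2⟩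
    obtain ⟨u, hu, hle⟩ := loc hf.2 i (|t| + 1)
    exact (continuousOn_tsum (fun m => (hf.1 (i, m)).continuousOn) hu hle).continuousAt
      (Metric.isOpen_ball.mem_nhds (mem t))
  | succ n ih =>
    obtain ⟨h, g, hg, hgn⟩ := hf
    refine ⟨glob h, _, fun i t => ?_, ih hgn⟩
    obtain ⟨u, hu, hle⟩ := loc h i (|t| + 1)
    obtain ⟨v, hv, hle'⟩ := loc hgn.polyBdd i (|t| + 1)
    exact hasDerivAt_tsum_of_isPreconnected hv Metric.isOpen_ball
      (convex_ball _ _).isPreconnected (fun m y _ => hg (i, m) y) hle' (mem t)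
      (Summable.of_norm_bounded hu fun m => hle m t (mem t)) (mem t)

end SmoothBdd

/-! ### The Bessel kernel: integral representation, recurrences, smoothness and lower bound -/

section Kernel

lemma add_rpow_le_two_mul {s A y : ℝ} (hs : 0 ≤ s) (hA : 0 ≤ A) (hy : 0 ≤ y) :
    (s + A) ^ y ≤ 2 ^ y * (s ^ y + A ^ y) := by
  have h1 := Real.rpow_nonneg hs y
  have h2 := Real.rpow_nonneg hA y
  calc (s + A) ^ y ≤ (2 * max s A) ^ y := by
        apply Real.rpow_le_rpow (by positivity) _ hy
        linarith [le_max_left s A, le_max_right s A]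
    _ = 2 ^ y * (max s A) ^ y := Real.mul_rpow (by norm_num) (le_max_of_le_left hs)
    _ ≤ _ := by
        gcongr
        rcases max_choice s A with h | h <;> rw [h] <;> linarith

lemma continuousOn_exp_rpow (x y : ℝ) {A : ℝ} (hA : 0 ≤ A) :
    ContinuousOn (fun s : ℝ => Real.exp (-s) * (s ^ x * (s + A) ^ y)) (Set.Ioi 0) := by
  have h1 : ContinuousOn (fun s : ℝ => s ^ x) (Set.Ioi 0) :=
    continuousOn_id.rpow_const fun s hs => Or.inl (ne_of_gt hs)
  have h2 : ContinuousOn (fun s : ℝ => (s + A) ^ y) (Set.Ioi 0) :=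
    (continuousOn_id.add continuousOn_const).rpow_const fun s hs =>
      Or.inl (ne_of_gt (add_pos_of_pos_of_nonneg hs hA))
  fun_prop

lemma integrableOn_exp_rpow_of_nonneg {x y A : ℝ} (hx : -1 < x) (hy : 0 ≤ y) (hA : 0 ≤ A) :
    IntegrableOn (fun s : ℝ => Real.exp (-s) * (s ^ x * (s + A) ^ y)) (Set.Ioi 0) := by
  have h1 := Real.GammaIntegral_convergent (s := x + y + 1) (by linarith)
  have h2 := Real.GammaIntegral_convergent (s := x + 1) (by linarith)
  refine Integrable.mono' ((h1.add (h2.const_mul (A ^ y))).const_mul (2 ^ y))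
    ((continuousOn_exp_rpow x y hA).aestronglyMeasurable measurableSet_Ioi) ?_
  filter_upwards [ae_restrict_mem measurableSet_Ioi] with s hs
  have hs : 0 < s := hs
  rw [Real.norm_of_nonneg (by positivity)]
  have h3 := add_rpow_le_two_mul hs.le hA hy
  calc _ ≤ Real.exp (-s) * (s ^ x * (2 ^ y * (s ^ y + A ^ y))) := by gcongr
    _ = _ := by
      simp only [Pi.add_apply, add_sub_cancel_right, Real.rpow_add hs]
      ring

lemma integrableOn_exp_rpow {x A : ℝ} (y : ℝ) (hx : -1 < x) (hA : 0 < A) :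
    IntegrableOn (fun s : ℝ => Real.exp (-s) * (s ^ x * (s + A) ^ y)) (Set.Ioi 0) := by
  refine Integrable.mono' ((integrableOn_exp_rpow_of_nonneg (y := y + |y|) hx
    (by linarith [neg_abs_le y]) hA.le).const_mul (A ^ (-|y|)))
    ((continuousOn_exp_rpow x y hA.le).aestronglyMeasurable measurableSet_Ioi) ?_
  filter_upwards [ae_restrict_mem measurableSet_Ioi] with s hs
  have hs : 0 < s := hs
  rw [Real.norm_of_nonneg (by positivity)]
  -- For `A > 0` a negative exponent is harmless: the factor `(s + A)^(-|y|)` is at most `A^(-|y|)`,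
  -- and what remains has exponent `y + |y| ≥ 0`.
  have h : (s + A) ^ y = (s + A) ^ (y + |y|) * (s + A) ^ (-|y|) := by
    rw [← Real.rpow_add (by positivity)]; ring_nf
  have h' : (s + A) ^ (-|y|) ≤ A ^ (-|y|) :=
    Real.rpow_le_rpow_of_nonpos hA (by linarith) (by simp)
  rw [h]
  calc _ ≤ Real.exp (-s) * (s ^ x * ((s + A) ^ (y + |y|) * A ^ (-|y|))) := by gcongr
    _ = _ := by ring

/-- Integration by parts against `e^{-s}` on `(0, ∞)`. -/
lemma integral_exp_mul_eq_deriv {G G' : ℝ → ℝ} (hc : ContinuousWithinAt G (Set.Ici 0) 0)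
    (h0 : G 0 = 0) (hd : ∀ s ∈ Set.Ioi (0 : ℝ), HasDerivAt G (G' s) s)
    (hG : IntegrableOn (fun s => Real.exp (-s) * G s) (Set.Ioi 0))
    (hG' : IntegrableOn (fun s => Real.exp (-s) * G' s) (Set.Ioi 0)) :
    ∫ s in Set.Ioi (0 : ℝ), Real.exp (-s) * G s = ∫ s in Set.Ioi (0 : ℝ), Real.exp (-s) * G' s := by
  have hd' : ∀ s ∈ Set.Ioi (0 : ℝ), HasDerivAt (fun s => Real.exp (-s) * G s)
      (Real.exp (-s) * G' s - Real.exp (-s) * G s) s := fun s hs => by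
    refine ((hasDerivAt_neg s).exp.mul (hd s hs)).congr_deriv ?_
    ring
  have hlim := tendsto_zero_of_hasDerivAt_of_integrableOn_Ioi hd' (hG'.sub hG) hG
  have hc' : ContinuousWithinAt (fun s => Real.exp (-s) * G s) (Set.Ici 0) 0 :=
    (by fun_prop : Continuous fun s : ℝ => Real.exp (-s)).continuousWithinAt.mul hc
  have h := integral_Ioi_of_hasDerivAt_of_tendsto hc' hd' (hG'.sub hG) hlim
  rw [integral_sub hG' hG, h0] at h
  linarith

/-- `∫_0^∞ e^{-s} (s (s + 2t))^b ds`. -/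
def kernelInt (b t : ℝ) : ℝ :=
  ∫ s in Set.Ioi (0 : ℝ), Real.exp (-s) * (s * (s + 2 * t)) ^ b

/-- The derivative of `kernelInt b`. -/
def kernelIntDeriv (b t : ℝ) : ℝ :=
  ∫ s in Set.Ioi (0 : ℝ), Real.exp (-s) * (2 * b * (s * (s * (s + 2 * t)) ^ (b - 1)))

lemma mul_rpow_split {s t : ℝ} (b : ℝ) (hs : 0 < s) (ht : 0 ≤ t) :
    (s * (s + 2 * t)) ^ b = s ^ b * (s + 2 * t) ^ b :=
  Real.mul_rpow hs.le (by positivity)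

lemma integrableOn_kernel {b t : ℝ} (hb : -1 < b) (ht : 0 < t) :
    IntegrableOn (fun s : ℝ => Real.exp (-s) * (s * (s + 2 * t)) ^ b) (Set.Ioi 0) :=
  (integrableOn_exp_rpow b hb (by positivity : 0 < 2 * t)).congr_fun
    (fun s hs => by simp only [mul_rpow_split b hs ht.le]) measurableSet_Ioi

lemma integrableOn_kernel_of_nonneg {b t : ℝ} (hb : 0 ≤ b) (ht : 0 ≤ t) :
    IntegrableOn (fun s : ℝ => Real.exp (-s) * (s * (s + 2 * t)) ^ b) (Set.Ioi 0) :=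
  (integrableOn_exp_rpow_of_nonneg (x := b) (by linarith) hb
    (by positivity : 0 ≤ 2 * t)).congr_fun
    (fun s hs => by simp only [mul_rpow_split b hs ht]) measurableSet_Ioi

lemma integrableOn_mul_kernel {b t : ℝ} (hb : -2 < b) (ht : 0 < t) :
    IntegrableOn (fun s : ℝ => Real.exp (-s) * (s * (s * (s + 2 * t)) ^ b)) (Set.Ioi 0) :=
  (integrableOn_exp_rpow b (by linarith : -1 < b + 1) (by positivity : 0 < 2 * t)).congr_fun
    (fun s hs => by
      simp only [mul_rpow_split b hs ht.le, Real.rpow_add_one (ne_of_gt hs)]; ring)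
    measurableSet_Ioi

lemma hasDerivAt_kernelInt {b t : ℝ} (hb : 0 ≤ b) (ht : 0 < t) :
    HasDerivAt (kernelInt b) (kernelIntDeriv b t) t := by
  have hU : Set.Ioo (t / 2) (2 * t) ∈ 𝓝 t := Ioo_mem_nhds (by linarith) (by linarith)
  refine (hasDerivAt_integral_of_dominated_loc_of_deriv_le (𝕜 := ℝ)
    (F := fun t s => Real.exp (-s) * (s * (s + 2 * t)) ^ b)
    (F' := fun t s => Real.exp (-s) * (2 * b * (s * (s * (s + 2 * t)) ^ (b - 1))))
    (bound := fun s => 2 * b * t⁻¹ * (Real.exp (-s) * (s ^ b * (s + 4 * t) ^ b))) hU ?_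
    (integrableOn_kernel_of_nonneg hb ht.le) ?_ ?_ ?_ ?_).2
  · filter_upwards [hU] with τ hτ
    exact (integrableOn_kernel_of_nonneg hb (by linarith [hτ.1])).1
  · have := (integrableOn_mul_kernel (b := b - 1) (by linarith) ht).const_mul (2 * b)
    refine this.1.congr (ae_of_all _ fun s => ?_)
    simp only
    ring
  · filter_upwards [ae_restrict_mem measurableSet_Ioi] with s hs τ hτ
    have hs : 0 < s := hs
    have hτ0 : 0 < τ := by linarith [hτ.1]
    rw [Real.norm_of_nonneg (by positivity), mul_rpow_split _ hs hτ0.le]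
    have h1 : s * s ^ (b - 1) = s ^ b := by
      rw [Real.rpow_sub_one hs.ne']; field_simp
    have h2 : (s + 2 * τ) ^ (b - 1) ≤ (s + 4 * t) ^ b * t⁻¹ := by
      rw [Real.rpow_sub_one (by positivity), div_eq_mul_inv]
      have h3 : s + 2 * τ ≤ s + 4 * t := by linarith [hτ.2]
      have h4 : t ≤ s + 2 * τ := by linarith [hτ.1]
      gcongr
    calc _ = Real.exp (-s) * (2 * b * (s ^ b * (s + 2 * τ) ^ (b - 1))) := by rw [← h1]; ring
      _ ≤ Real.exp (-s) * (2 * b * (s ^ b * ((s + 4 * t) ^ b * t⁻¹))) := by gcongr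
      _ = _ := by ring
  · exact (integrableOn_exp_rpow_of_nonneg (by linarith) hb (by positivity)).const_mul _
  · filter_upwards [ae_restrict_mem measurableSet_Ioi] with s hs τ hτ
    have hs : 0 < s := hs
    have hτ0 : 0 < τ := by linarith [hτ.1]
    have h1 : HasDerivAt (fun τ : ℝ => s * (s + 2 * τ)) (s * 2) τ := by
      simpa using (((hasDerivAt_id τ).const_mul 2).const_add s).const_mul s
    refine ((h1.rpow_const (p := b) (Or.inl (by positivity))).const_mul _).congr_deriv ?_
    ring

lemma hasDerivAt_quadratic (s t : ℝ) :
    HasDerivAt (fun s : ℝ => s * (s + 2 * t)) (2 * (s + t)) s := by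
  refine ((hasDerivAt_id s).mul ((hasDerivAt_id s).add_const (2 * t))).congr_deriv ?_
  simp only [id]
  ring

/-- Integration by parts with `G = (s (s + 2t))^b`, whose derivative splits along `s + t`. This
produces the Bessel rule `(r^ν K_ν)' = -r^ν K_{ν-1}` in the form used for `kernelDeriv`. -/
lemma kernelInt_eq {b t : ℝ} (hb : 0 < b) (ht : 0 < t) :
    kernelInt b t = kernelIntDeriv b t + 2 * b * t * kernelInt (b - 1) t := by
  have i1 := (integrableOn_mul_kernel (b := b - 1) (by linarith) ht).const_mul (2 * b)
  have i2 := (integrableOn_kernel (b := b - 1) (by linarith) ht).const_mul (2 * b * t)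
  have h := integral_exp_mul_eq_deriv (G := fun s => (s * (s + 2 * t)) ^ b)
    (G' := fun s => 2 * b * (s * (s * (s + 2 * t)) ^ (b - 1)) +
      2 * b * t * (s * (s + 2 * t)) ^ (b - 1))
    ((by fun_prop : Continuous fun s : ℝ => s * (s + 2 * t)).rpow_const
      fun _ => Or.inr hb.le).continuousWithinAt (by simp [Real.zero_rpow hb.ne'])
    (fun s hs => ?_) (integrableOn_kernel (by linarith) ht) ?_
  · rw [kernelInt, h, kernelIntDeriv, kernelInt, ← integral_const_mul, ← integral_add]
    · congr 1; ext s; ring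
    · refine i1.congr (ae_of_all _ fun s => ?_); simp only; ring
    · exact i2
  · have hs : 0 < s := hs
    refine ((hasDerivAt_quadratic s t).rpow_const (Or.inl (by positivity))).congr_deriv ?_
    ring
  · refine (i1.add i2).congr (ae_of_all _ fun s => ?_)
    simp only [Pi.add_apply]; ring

/-- Integration by parts with `G = s (s (s + 2t))^b`. Used with `b - 1` for `b`, it closes the
system of recurrences and gives the second derivative of the kernel. -/
lemma kernelIntDeriv_add_one {b t : ℝ} (hb : 0 ≤ b) (ht : 0 < t) :
    kernelIntDeriv (b + 1) t =
      2 * (b + 1) * ((2 * b + 1) * kernelInt b t - t * kernelIntDeriv b t) := by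
  have i1 := (integrableOn_kernel (b := b) (by linarith) ht).const_mul (2 * b + 1)
  have i2 := (integrableOn_mul_kernel (b := b - 1) (by linarith) ht).const_mul (t * (2 * b))
  have h := integral_exp_mul_eq_deriv (G := fun s => s * (s * (s + 2 * t)) ^ b)
    (G' := fun s => (2 * b + 1) * (s * (s + 2 * t)) ^ b -
      t * (2 * b * (s * (s * (s + 2 * t)) ^ (b - 1))))
    ((continuous_id.mul ((by fun_prop : Continuous fun s : ℝ => s * (s + 2 * t)).rpow_const
      fun _ => Or.inr hb)).continuousWithinAt) (by simp)
    (fun s hs => ?_) (integrableOn_mul_kernel (by linarith) ht) ?_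
  · have h1 : kernelIntDeriv (b + 1) t =
        2 * (b + 1) * ∫ s in Set.Ioi (0 : ℝ), Real.exp (-s) * (s * (s * (s + 2 * t)) ^ b) := by
      rw [kernelIntDeriv, ← integral_const_mul]
      congr 1; ext s; rw [add_sub_cancel_right]; ring
    rw [h1, h]
    congr 1
    rw [kernelInt, kernelIntDeriv, ← integral_const_mul, ← integral_const_mul, ← integral_sub i1]
    · congr 1; ext s; ring
    · refine i2.congr (ae_of_all _ fun s => ?_); simp only; ring
  · have hs : 0 < s := hs
    have hX : 0 < s * (s + 2 * t) := by positivity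
    refine ((hasDerivAt_id s).mul
      ((hasDerivAt_quadratic s t).rpow_const (p := b) (Or.inl hX.ne'))).congr_deriv ?_
    have h1 : (s * (s + 2 * t)) ^ b = (s * (s + 2 * t)) ^ (b - 1) * (s * (s + 2 * t)) := by
      rw [← Real.rpow_add_one hX.ne']; ring_nf
    simp only [id]
    rw [h1]
    ring
  · refine (i1.sub i2).congr (ae_of_all _ fun s => ?_)
    simp only [Pi.sub_apply]; ring

lemma rpow_kernel_le {s t A b : ℝ} (hs : 0 < s) (ht : |t| ≤ A) (hb : 0 ≤ b) :
    (s * (s + 2 * |t|)) ^ b ≤ s ^ b * (s + 2 * A) ^ b := by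
  rw [mul_rpow_split b hs (abs_nonneg t)]
  gcongr

/-- Since `|t| ≤ s + 2|t|`, the factor `|t|` raises the exponent of `s + 2|t|` from `b - 1` to `b`.
What is left, `s^(b-1)`, is integrable at 0 for every `b > 0`, although `kernelInt (b - 1)` itself
may blow up as `t → 0`. -/
lemma abs_mul_rpow_kernel_le {s t A b : ℝ} (hs : 0 < s) (ht : |t| ≤ A) (hb : 0 ≤ b) :
    |t| * (s * (s + 2 * |t|)) ^ (b - 1) ≤ s ^ (b - 1) * (s + 2 * A) ^ b := by
  have h0 : 0 < s + 2 * |t| := by positivity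
  have hA : 0 ≤ A := (abs_nonneg t).trans ht
  rw [mul_rpow_split _ hs (abs_nonneg t), Real.rpow_sub_one h0.ne']
  have h1 : |t| * ((s + 2 * |t|) ^ b / (s + 2 * |t|)) ≤ (s + 2 * A) ^ b := by
    rw [← mul_div_assoc, div_le_iff₀ h0, mul_comm]
    have : (s + 2 * |t|) ^ b ≤ (s + 2 * A) ^ b := by gcongr
    apply mul_le_mul this _ (abs_nonneg t) (by positivity)
    linarith [abs_nonneg t]
  calc _ = s ^ (b - 1) * (|t| * ((s + 2 * |t|) ^ b / (s + 2 * |t|))) := by ring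
    _ ≤ _ := by gcongr

lemma continuous_kernelInt {b : ℝ} (hb : 0 ≤ b) : Continuous fun t : ℝ => kernelInt b |t| := by
  refine continuous_iff_continuousAt.2 fun t₀ => ?_
  have hnear : ∀ᶠ t : ℝ in 𝓝 t₀, |t| ≤ |t₀| + 1 := by
    filter_upwards [continuous_abs.continuousAt.eventually (gt_mem_nhds (lt_add_one |t₀|))]
      with t ht using ht.le
  refine continuousAt_of_dominated (bound := fun s =>
    Real.exp (-s) * (s ^ b * (s + 2 * (|t₀| + 1)) ^ b))
    (.of_forall fun t => (integrableOn_kernel_of_nonneg hb (abs_nonneg t)).1) ?_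
    (integrableOn_exp_rpow_of_nonneg (by linarith) hb (by positivity)) ?_
  · filter_upwards [hnear] with t ht
    filter_upwards [ae_restrict_mem measurableSet_Ioi] with s hs
    have hs : 0 < s := hs
    rw [Real.norm_of_nonneg (by positivity)]
    exact mul_le_mul_of_nonneg_left (rpow_kernel_le hs ht hb) (Real.exp_nonneg _)
  · refine ae_of_all _ fun s => Continuous.continuousAt ?_
    exact continuous_const.mul ((by fun_prop : Continuous fun t : ℝ =>
      s * (s + 2 * |t|)).rpow_const fun _ => Or.inr hb)

lemma continuous_mul_kernelInt {b : ℝ} (hb : 0 < b) :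
    Continuous fun t : ℝ => t * kernelInt (b - 1) |t| := by
  have heq : (fun t : ℝ => t * kernelInt (b - 1) |t|) = fun t =>
      ∫ s in Set.Ioi (0 : ℝ), Real.exp (-s) * (t * (s * (s + 2 * |t|)) ^ (b - 1)) := by
    ext t
    rw [kernelInt, ← integral_const_mul]
    congr 1; ext s; ring
  rw [heq]
  have hcont : ∀ t : ℝ, ContinuousOn
      (fun s : ℝ => Real.exp (-s) * (t * (s * (s + 2 * |t|)) ^ (b - 1))) (Set.Ioi 0) := by
    intro t
    have : ContinuousOn (fun s : ℝ => (s * (s + 2 * |t|)) ^ (b - 1)) (Set.Ioi 0) :=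
      (by fun_prop : Continuous fun s : ℝ => s * (s + 2 * |t|)).continuousOn.rpow_const
        fun s hs => Or.inl (by have : (0 : ℝ) < s := hs; positivity)
    fun_prop
  refine continuous_iff_continuousAt.2 fun t₀ => ?_
  have hnear : ∀ᶠ t : ℝ in 𝓝 t₀, |t| ≤ |t₀| + 1 := by
    filter_upwards [continuous_abs.continuousAt.eventually (gt_mem_nhds (lt_add_one |t₀|))]
      with t ht using ht.le
  refine continuousAt_of_dominated (bound := fun s =>
    Real.exp (-s) * (s ^ (b - 1) * (s + 2 * (|t₀| + 1)) ^ b))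
    (.of_forall fun t => (hcont t).aestronglyMeasurable measurableSet_Ioi) ?_
    (integrableOn_exp_rpow_of_nonneg (by linarith) hb.le (by positivity)) ?_
  · filter_upwards [hnear] with t ht
    filter_upwards [ae_restrict_mem measurableSet_Ioi] with s hs
    have hs : 0 < s := hs
    rw [norm_mul, norm_mul, Real.norm_of_nonneg (Real.exp_nonneg _), Real.norm_eq_abs t,
      Real.norm_of_nonneg (Real.rpow_nonneg (by positivity) _)]
    exact mul_le_mul_of_nonneg_left (abs_mul_rpow_kernel_le hs ht hb.le) (Real.exp_nonneg _)
  · filter_upwards [ae_restrict_mem measurableSet_Ioi] with s hs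
    have hs : 0 < s := hs
    refine Continuous.continuousAt ?_
    exact continuous_const.mul (continuous_id.mul ((by fun_prop : Continuous fun t : ℝ =>
      s * (s + 2 * |t|)).rpow_const fun t => Or.inl (by positivity)))

lemma add_two_mul_rpow_le {s r b : ℝ} (hs : 0 < s) (hr : 0 ≤ r) (hb : 0 ≤ b) :
    (s + 2 * r) ^ b ≤ (1 + r) ^ ⌈b⌉₊ * (s + 2) ^ b := by
  have h1 : (s + 2 * r) ^ b ≤ ((1 + r) * (s + 2)) ^ b := by
    gcongr
    nlinarith
  have h2 : (1 + r) ^ b ≤ (1 + r) ^ ⌈b⌉₊ := by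
    rw [← Real.rpow_natCast]
    exact Real.rpow_le_rpow_of_exponent_le (by linarith) (Nat.le_ceil b)
  refine h1.trans ?_
  rw [Real.mul_rpow (by positivity) (by positivity)]
  gcongr

lemma abs_kernelInt_le {b : ℝ} (hb : 0 ≤ b) : ∃ C, 0 ≤ C ∧
    ∀ t : ℝ, |kernelInt b (|t|)| ≤ C * (1 + |t|) ^ ⌈b⌉₊ := by
  have hi := integrableOn_exp_rpow_of_nonneg (x := b) (A := 2) (by linarith) hb (by norm_num)
  refine ⟨∫ s in Set.Ioi (0 : ℝ), Real.exp (-s) * (s ^ b * (s + 2) ^ b),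
    setIntegral_nonneg measurableSet_Ioi fun s hs => ?_, fun t => ?_⟩
  · have hs : 0 < s := hs
    positivity
  rw [← integral_mul_const, ← Real.norm_eq_abs, kernelInt]
  refine norm_integral_le_of_norm_le (hi.mul_const _) ?_
  filter_upwards [ae_restrict_mem measurableSet_Ioi] with s hs
  have hs : 0 < s := hs
  rw [Real.norm_of_nonneg (by positivity)]
  calc _ ≤ Real.exp (-s) * (s ^ b * ((1 + |t|) ^ ⌈b⌉₊ * (s + 2) ^ b)) := by
        gcongr
        exact (rpow_kernel_le hs le_rfl hb).trans
          (by gcongr; exact add_two_mul_rpow_le hs (abs_nonneg t) hb)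
    _ = _ := by ring

lemma abs_mul_kernelInt_le {b : ℝ} (hb : 0 < b) : ∃ C, 0 ≤ C ∧
    ∀ t : ℝ, |t * kernelInt (b - 1) (|t|)| ≤ C * (1 + |t|) ^ ⌈b⌉₊ := by
  have hi := integrableOn_exp_rpow_of_nonneg (x := b - 1) (A := 2) (by linarith) hb.le
    (by norm_num)
  refine ⟨∫ s in Set.Ioi (0 : ℝ), Real.exp (-s) * (s ^ (b - 1) * (s + 2) ^ b),
    setIntegral_nonneg measurableSet_Ioi fun s hs => ?_, fun t => ?_⟩
  · have hs : 0 < s := hs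
    positivity
  rw [← integral_mul_const, ← Real.norm_eq_abs, kernelInt, ← integral_const_mul]
  refine norm_integral_le_of_norm_le (hi.mul_const _) ?_
  filter_upwards [ae_restrict_mem measurableSet_Ioi] with s hs
  have hs : 0 < s := hs
  rw [norm_mul, norm_mul, Real.norm_of_nonneg (Real.exp_nonneg _), Real.norm_eq_abs t,
    Real.norm_of_nonneg (Real.rpow_nonneg (by positivity) _)]
  calc _ = Real.exp (-s) * (|t| * (s * (s + 2 * |t|)) ^ (b - 1)) := by ring
    _ ≤ Real.exp (-s) * (s ^ (b - 1) * ((1 + |t|) ^ ⌈b⌉₊ * (s + 2) ^ b)) := by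
        refine mul_le_mul_of_nonneg_left ?_ (Real.exp_nonneg _)
        exact (abs_mul_rpow_kernel_le hs le_rfl hb.le).trans
          (mul_le_mul_of_nonneg_left (add_two_mul_rpow_le hs (abs_nonneg t) hb.le) (by positivity))
    _ = _ := by ring

/-- The even function `e^{-|t|} ∫_0^∞ e^{-s} (s (s + 2|t|))^b ds`, a constant multiple of
`|t|^{b + 1/2} K_{b + 1/2}(|t|)`. -/
def kernel (b t : ℝ) : ℝ := Real.exp (-|t|) * kernelInt b |t|

/-- The derivative of `kernel b`. -/
def kernelDeriv (b t : ℝ) : ℝ := -2 * b * (Real.exp (-|t|) * (t * kernelInt (b - 1) |t|))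

lemma kernel_neg (b t : ℝ) : kernel b (-t) = kernel b t := by simp [kernel]

lemma kernelDeriv_neg (b t : ℝ) : kernelDeriv b (-t) = -kernelDeriv b t := by
  simp [kernelDeriv]

lemma continuous_kernel {b : ℝ} (hb : 0 ≤ b) : Continuous (kernel b) :=
  (by fun_prop : Continuous fun t : ℝ => Real.exp (-|t|)).mul (continuous_kernelInt hb)

lemma continuous_kernelDeriv {b : ℝ} (hb : 0 < b) : Continuous (kernelDeriv b) :=
  continuous_const.mul ((by fun_prop : Continuous fun t : ℝ => Real.exp (-|t|)).mul
    (continuous_mul_kernelInt hb))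

lemma hasDerivAt_exp_neg_mul {f : ℝ → ℝ} {f' t : ℝ} (h : HasDerivAt f f' t) :
    HasDerivAt (fun t => Real.exp (-t) * f t) (Real.exp (-t) * (f' - f t)) t := by
  refine ((hasDerivAt_neg t).exp.mul h).congr_deriv ?_
  ring

lemma eventually_abs_eq {t : ℝ} (ht : 0 < t) : ∀ᶠ τ in 𝓝 t, |τ| = τ := by
  filter_upwards [lt_mem_nhds ht] with τ hτ using abs_of_pos hτ

lemma hasDerivAt_kernel_of_pos {b t : ℝ} (hb : 0 < b) (ht : 0 < t) :
    HasDerivAt (kernel b) (kernelDeriv b t) t := by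
  have h := hasDerivAt_exp_neg_mul (hasDerivAt_kernelInt hb.le ht)
  refine (h.congr_of_eventuallyEq ?_).congr_deriv ?_
  · filter_upwards [eventually_abs_eq ht] with τ hτ
    rw [kernel, hτ]
  · rw [kernelDeriv, abs_of_pos ht, kernelInt_eq hb ht]
    ring

/-- The two recurrences express the second derivative through kernels alone, with no division by
`t`; two derivatives thus cost one unit of `b`. -/
lemma hasDerivAt_kernelDeriv_of_pos {b t : ℝ} (hb : 1 ≤ b) (ht : 0 < t) :
    HasDerivAt (kernelDeriv b) (kernel b t - 4 * b ^ 2 * kernel (b - 1) t) t := by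
  have h := (hasDerivAt_exp_neg_mul ((hasDerivAt_id t).mul
    (hasDerivAt_kernelInt (b := b - 1) (by linarith) ht))).const_mul (-2 * b)
  refine (h.congr_of_eventuallyEq ?_).congr_deriv ?_
  · filter_upwards [eventually_abs_eq ht] with τ hτ
    rw [kernelDeriv, hτ]
    rfl
  · have h1 := kernelIntDeriv_add_one (b := b - 1) (by linarith) ht
    rw [sub_add_cancel] at h1
    rw [kernel, kernel, abs_of_pos ht, kernelInt_eq (b := b) (by linarith) ht, h1]
    simp only [id, Pi.mul_apply]
    ring

/-- Parity reduces negative `t` to positive `t`, and at 0 the derivative is the limit of the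
derivatives, since `kernel b` and `kernelDeriv b` are continuous. -/
lemma hasDerivAt_kernel {b : ℝ} (hb : 0 < b) (t : ℝ) :
    HasDerivAt (kernel b) (kernelDeriv b t) t := by
  have hne : ∀ t : ℝ, t ≠ 0 → HasDerivAt (kernel b) (kernelDeriv b t) t := by
    intro t ht
    rcases ht.lt_or_gt with ht | ht
    · have h := (hasDerivAt_kernel_of_pos hb (neg_pos.2 ht)).comp t (hasDerivAt_neg t)
      have h1 : kernel b ∘ Neg.neg = kernel b := funext fun t => kernel_neg b t
      rw [h1, kernelDeriv_neg] at h
      exact h.congr_deriv (by ring)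
    · exact hasDerivAt_kernel_of_pos hb ht
  exact hasDerivAt_of_hasDerivAt_of_ne' hne (continuous_kernel hb.le).continuousAt
    (continuous_kernelDeriv hb).continuousAt t

lemma hasDerivAt_kernelDeriv {b : ℝ} (hb : 1 ≤ b) (t : ℝ) :
    HasDerivAt (kernelDeriv b) (kernel b t - 4 * b ^ 2 * kernel (b - 1) t) t := by
  have hne : ∀ t : ℝ, t ≠ 0 →
      HasDerivAt (kernelDeriv b) (kernel b t - 4 * b ^ 2 * kernel (b - 1) t) t := by
    intro t ht
    rcases ht.lt_or_gt with ht | ht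
    · have h := ((hasDerivAt_kernelDeriv_of_pos hb (neg_pos.2 ht)).comp t
        (hasDerivAt_neg t)).neg
      have h1 : -(kernelDeriv b ∘ Neg.neg) = kernelDeriv b :=
        funext fun t => by simp [kernelDeriv_neg]
      rw [h1, kernel_neg, kernel_neg] at h
      exact h.congr_deriv (by ring)
    · exact hasDerivAt_kernelDeriv_of_pos hb ht
  exact hasDerivAt_of_hasDerivAt_of_ne' (g := fun t => kernel b t - 4 * b ^ 2 * kernel (b - 1) t)
    hne (continuous_kernelDeriv (by linarith)).continuousAt
    ((continuous_kernel (by linarith)).sub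
      (continuous_const.mul (continuous_kernel (by linarith)))).continuousAt t

lemma polyBdd_exp_neg_mul {f : ℝ → ℝ} {C : ℝ} {M : ℕ} (hC : 0 ≤ C)
    (h : ∀ t : ℝ, |f t| ≤ C * (1 + |t|) ^ M) (q : ℝ) :
    PolyBdd Set.univ (fun (_ : Unit) t => 1 + |t|) (fun _ t => Real.exp (-|t|))
      (fun _ t => q * (Real.exp (-|t|) * f t)) := by
  refine ⟨|q| * C, M, by positivity, fun _ t _ => ?_⟩
  rw [norm_mul, norm_mul, Real.norm_of_nonneg (Real.exp_nonneg _), Real.norm_eq_abs,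
    Real.norm_eq_abs]
  calc _ ≤ |q| * (Real.exp (-|t|) * (C * (1 + |t|) ^ M)) := by gcongr; exact h t
    _ = _ := by ring

/-- Two-step induction along `kernel b'' = kernel b - 4b² kernel (b - 1)`: `n` drops by 2 while `2b`
drops by at most 2, so `n ≤ 2b` persists. -/
lemma smoothBdd_kernel (n : ℕ) {b : ℝ} (hb : (n : ℝ) ≤ 2 * b) :
    SmoothBdd Set.univ (fun (_ : Unit) t => 1 + |t|) (fun _ t => Real.exp (-|t|)) n
      (fun _ => kernel b) := by
  have key : ∀ {b : ℝ}, 0 ≤ b → PolyBdd Set.univ (fun (_ : Unit) t => 1 + |t|)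
      (fun _ t => Real.exp (-|t|)) (fun _ => kernel b) := by
    intro b hb
    obtain ⟨C, hC, h⟩ := abs_kernelInt_le hb
    have := polyBdd_exp_neg_mul hC h 1
    simp only [one_mul] at this
    exact this
  have key' : ∀ {b : ℝ}, 0 < b → PolyBdd Set.univ (fun (_ : Unit) t => 1 + |t|)
      (fun _ t => Real.exp (-|t|)) (fun _ => kernelDeriv b) := by
    intro b hb
    obtain ⟨C, hC, h⟩ := abs_mul_kernelInt_le hb
    exact polyBdd_exp_neg_mul hC h _
  induction n using Nat.twoStepInduction generalizing b with
  | zero =>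
    have hb : 0 ≤ b := by push_cast at hb; linarith
    exact ⟨fun _ => continuous_kernel hb, key hb⟩
  | one =>
    have hb : 0 < b := by push_cast at hb; linarith
    exact ⟨key hb.le, _, fun _ => hasDerivAt_kernel hb, fun _ => continuous_kernelDeriv hb,
      key' hb⟩
  | more n ih _ =>
    push_cast at hb
    have hn : (0 : ℝ) ≤ n := Nat.cast_nonneg n
    have h1 : 1 ≤ b := by linarith
    have hρ : ∀ (_ : Unit) (t : ℝ), 1 ≤ 1 + |t| := fun _ t => by linarith [abs_nonneg t]
    refine ⟨key (by linarith), _, fun _ => hasDerivAt_kernel (by linarith), key' (by linarith), _,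
      fun _ => hasDerivAt_kernelDeriv h1, ?_⟩
    have h2 := (ih (b := b) (by linarith)).add hρ (fun _ t => (Real.exp_pos _).le)
      ((ih (b := b - 1) (by linarith)).const_mul hρ (-(4 * b ^ 2)))
    simpa only [neg_mul, ← sub_eq_add_neg] using h2

/-- Drop `2|t|` from `s (s + 2|t|) ≥ s²`; the remaining integral of `e^{-s} s^{2b}` is `Γ(2b + 1)`.
-/
lemma le_kernel {b : ℝ} (hb : 0 ≤ b) (t : ℝ) :
    Real.Gamma (2 * b + 1) * Real.exp (-|t|) ≤ kernel b t := by
  have h : Real.Gamma (2 * b + 1) ≤ kernelInt b |t| := by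
    rw [Real.Gamma_eq_integral (by linarith), kernelInt]
    refine setIntegral_mono_on (Real.GammaIntegral_convergent (by linarith))
      (integrableOn_kernel_of_nonneg hb (abs_nonneg t)) measurableSet_Ioi fun s hs => ?_
    have hs : 0 < s := hs
    rw [add_sub_cancel_right, mul_comm 2 b, Real.rpow_mul hs.le, Real.rpow_two]
    have := abs_nonneg t
    rw [← Real.rpow_two, ← Real.rpow_mul hs.le, mul_comm b 2, Real.rpow_mul hs.le, Real.rpow_two]
    gcongr
    nlinarith
  rw [kernel, mul_comm]
  gcongr

end Kernel

/-! ### Desingularized transform, its periodization, and the error term -/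

section Periodization

/-- `∫_0^1 u^j cos (x u + θ) du`. -/
def cosMoment (j : ℕ) (θ x : ℝ) : ℝ := ∫ u in (0 : ℝ)..1, u ^ j * Real.cos (x * u + θ)

lemma hasDerivAt_cosMoment (j : ℕ) (θ x : ℝ) :
    HasDerivAt (cosMoment j θ) (cosMoment (j + 1) (θ + Real.pi / 2) x) x := by
  refine (intervalIntegral.hasDerivAt_integral_of_dominated_loc_of_deriv_le (𝕜 := ℝ)
    (F := fun x u => u ^ j * Real.cos (x * u + θ))
    (F' := fun x u => u ^ (j + 1) * Real.cos (x * u + (θ + Real.pi / 2)))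
    (bound := fun _ => 1) (Filter.univ_mem) (.of_forall fun x => ?_) ?_ ?_ ?_ ?_ ?_).2
  · exact (by fun_prop : Continuous fun u : ℝ =>
      u ^ j * Real.cos (x * u + θ)).aestronglyMeasurable
  · exact (by fun_prop : Continuous fun u : ℝ =>
      u ^ j * Real.cos (x * u + θ)).intervalIntegrable _ _
  · exact (by fun_prop : Continuous fun u : ℝ =>
      u ^ (j + 1) * Real.cos (x * u + (θ + Real.pi / 2))).aestronglyMeasurable
  · refine ae_of_all _ fun u hu x _ => ?_
    rw [Set.uIoc_of_le zero_le_one] at hu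
    rw [norm_mul, norm_pow, Real.norm_of_nonneg hu.1.le]
    exact mul_le_one₀ (pow_le_one₀ hu.1.le hu.2) (norm_nonneg _) (Real.abs_cos_le_one _)
  · exact intervalIntegrable_const
  · refine ae_of_all _ fun u _ x _ => ?_
    have h := ((Real.hasDerivAt_cos (x * u + θ)).comp x
      (((hasDerivAt_id x).mul_const u).add_const θ)).const_mul (u ^ j)
    refine h.congr_deriv ?_
    rw [← add_assoc, Real.cos_add_pi_div_two]
    ring

lemma abs_cosMoment_le (j : ℕ) (θ x : ℝ) : |cosMoment j θ x| ≤ 1 := by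
  have := intervalIntegral.norm_integral_le_of_norm_le_const (a := 0) (b := 1) (C := 1)
    (f := fun u => u ^ j * Real.cos (x * u + θ)) fun u hu => ?_
  · simpa [cosMoment] using this
  · rw [Set.uIoc_of_le zero_le_one] at hu
    rw [norm_mul, norm_pow, Real.norm_of_nonneg hu.1.le]
    exact mul_le_one₀ (pow_le_one₀ hu.1.le hu.2) (norm_nonneg _) (Real.abs_cos_le_one _)

/-- Each derivative raises the power of `u` and shifts the phase by `π/2`, giving another moment
bounded by 1. This bounds all derivatives of `sinc` without treating the quotient at 0. -/
lemma smoothBdd_cosMoment {S : Set ℝ} (n j : ℕ) (θ : ℝ) :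
    SmoothBdd S (fun (_ : Unit) _ => 1) (fun _ _ => 1) n (fun _ => cosMoment j θ) := by
  have key : ∀ j θ, PolyBdd S (fun (_ : Unit) _ => 1) (fun _ _ => 1) (fun _ => cosMoment j θ) :=
    fun j θ => ⟨1, 0, zero_le_one, fun _ t _ => by simpa using abs_cosMoment_le j θ t⟩
  induction n generalizing j θ with
  | zero =>
    exact ⟨fun _ => continuous_iff_continuousAt.2 fun x => (hasDerivAt_cosMoment j θ x).continuousAt,
      key j θ⟩
  | succ n ih => exact ⟨key j θ, _, fun _ => hasDerivAt_cosMoment j θ, ih _ _⟩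

lemma sinc_eq_cosMoment : Real.sinc = cosMoment 0 0 := by
  ext x
  rcases eq_or_ne x 0 with rfl | hx
  · simp [cosMoment]
  · rw [Real.sinc_of_ne_zero hx, cosMoment]
    simp only [pow_zero, one_mul, add_zero]
    rw [intervalIntegral.integral_comp_mul_left (fun u => Real.cos u) hx]
    simp [div_eq_inv_mul]

/-- Indices `(κ, x)` with `κ ≥ κ₀`. -/
abbrev Idx (κ₀ : ℝ) : Type := Set.Ici κ₀ × ℝ

/-- The transform `|ξ|^{-p} kernel a (c ξ)` at `ξ = 2πs`, `κ = 2πc`, multiplied by a power of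
`|sin (π s)|` which removes its singularity, up to a constant. -/
def psi (a p κ s : ℝ) : ℝ := |Real.sinc (Real.pi * s)| ^ p * kernel a (κ * s)

/-- The periodization of `psi`. -/
def psiSum (a p κ s : ℝ) : ℝ := ∑' m : ℤ, psi a p κ (s + m)

variable {a p κ₀ : ℝ} {n : ℕ}

lemma smoothBdd_sinc_rpow (hp : p = 0 ∨ (n : ℝ) < p) :
    SmoothBdd Set.univ (fun (_ : Unit) _ => 1) (fun _ _ => 1) n
      (fun _ s => |Real.sinc s| ^ p) := by
  rcases hp with rfl | hp
  · simpa using smoothBdd_const (𝕜 := ℝ) (ι := Unit) 1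
  · rw [sinc_eq_cosMoment]
    exact ((smoothBdd_cosMoment n 0 0).abs_rpow (fun _ _ => le_rfl) hp).1

lemma smoothBdd_psi_shift (hκ₀ : 0 < κ₀) (ha : (n : ℝ) ≤ 2 * a) (hp : p = 0 ∨ (n : ℝ) < p)
    (q : Idx κ₀ × ℤ → ℂ) :
    SmoothBdd Set.univ (fun (j : Idx κ₀ × ℤ) t => (1 + (j.1.1 : ℝ)) * (1 + |t + j.2|))
      (fun j t => Real.exp (-((j.1.1 : ℝ) * |t + j.2|)) * ‖q j‖) n
      (fun j t => q j * (psi a p j.1.1 (t + j.2) : ℂ)) := by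
  have hκ : ∀ j : Idx κ₀ × ℤ, 0 < (j.1.1 : ℝ) := fun j => hκ₀.trans_le j.1.1.2
  have hρ : ∀ (j : Idx κ₀ × ℤ) (t : ℝ), 1 ≤ (1 + (j.1.1 : ℝ)) * (1 + |t + j.2|) := fun j t => by
    nlinarith [hκ j, abs_nonneg (t + j.2)]
  have hρκ : ∀ (j : Idx κ₀ × ℤ) (t : ℝ),
      (j.1.1 : ℝ) ≤ (1 + (j.1.1 : ℝ)) * (1 + |t + j.2|) := fun j t => by
    nlinarith [hκ j, abs_nonneg (t + j.2), mul_nonneg (hκ j).le (abs_nonneg (t + j.2))]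
  have h1 := (smoothBdd_sinc_rpow hp).comp_affine (ι' := Idx κ₀ × ℤ) (S' := Set.univ)
    (ρ' := fun j t => (1 + (j.1.1 : ℝ)) * (1 + |t + j.2|)) (W' := fun _ _ => 1)
    (fun _ => ()) (fun _ => Real.pi) (fun j => Real.pi * j.2) (fun _ => 1)
    (fun _ _ _ => trivial) hρ (fun _ => zero_le_one)
    ⟨Real.pi, 0, Real.pi_pos.le, fun _ _ _ => by simp [abs_of_pos Real.pi_pos]⟩
    (fun M => ⟨1, 0, by simp⟩) (fun _ => 1) ⟨1, 0, by simp⟩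
  have h2 := (smoothBdd_kernel n ha).comp_affine (ι' := Idx κ₀ × ℤ) (S' := Set.univ)
    (ρ' := fun j t => (1 + (j.1.1 : ℝ)) * (1 + |t + j.2|))
    (W' := fun j t => Real.exp (-((j.1.1 : ℝ) * |t + j.2|)))
    (fun _ => ()) (fun j => (j.1.1 : ℝ)) (fun j => j.1.1 * j.2) (fun _ => 1)
    (fun _ _ _ => trivial) hρ (fun _ => zero_le_one)
    ⟨1, 1, zero_le_one, fun j t _ => by
      rw [abs_of_pos (hκ j), one_mul, pow_one]; exact hρκ j t⟩
    (fun M => ⟨1, M, zero_le_one, fun j t _ => ?_⟩) (fun _ => 1) ⟨1, 0, by simp⟩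
  · have h3 := (h1.mul hρ (fun _ _ => zero_le_one) (fun _ _ => (Real.exp_pos _).le) h2).ofReal
    have h4 := h3.comp_affine (S' := Set.univ)
      (ρ' := fun (j : Idx κ₀ × ℤ) t => (1 + (j.1.1 : ℝ)) * (1 + |t + j.2|))
      (W' := fun j t => Real.exp (-((j.1.1 : ℝ) * |t + j.2|)) * ‖q j‖)
      id (fun _ => 1) (fun _ => 0) (fun j => ‖q j‖)
      (fun _ _ _ => trivial) hρ (fun _ => norm_nonneg _) ⟨1, 0, by simp⟩
      (fun M => ⟨1, M, zero_le_one, fun j t _ => by simp [mul_assoc]⟩) q ⟨1, 0, by simp⟩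
    have h5 : (fun (j : Idx κ₀ × ℤ) (t : ℝ) => q j * (psi a p j.1.1 (t + j.2) : ℂ)) =
        fun j t => q j * (((1 * |Real.sinc (Real.pi * (1 * t + 0) + Real.pi * j.2)| ^ p) *
          (1 * kernel a (j.1.1 * (1 * t + 0) + j.1.1 * j.2)) : ℝ) : ℂ) := by
      ext j t
      simp only [psi, one_mul, add_zero, mul_add]
    rw [h5]
    exact h4
  · have h : |(j.1.1 : ℝ) * t + j.1.1 * j.2| = j.1.1 * |t + j.2| := by
      rw [← mul_add, abs_mul, abs_of_pos (hκ j)]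
    have := hκ j
    rw [h, mul_one, one_mul]
    gcongr
    nlinarith [abs_nonneg (t + j.2)]

/-- Half of the exponential pays for the polynomial, by `z^M / M! ≤ e^z` at `z = κ(A + y)/2`. -/
lemma pow_mul_exp_le (M : ℕ) {A κ y : ℝ} (hκ : 0 < κ) (hA : 0 ≤ A) (hy : 0 ≤ y) :
    (A + y) ^ M * Real.exp (-(κ * y)) ≤
      (2 / κ) ^ M * M.factorial * Real.exp (κ / 2 * A) * Real.exp (-(κ / 2 * y)) := by
  have h := Real.pow_div_factorial_le_exp (κ / 2 * (A + y)) (by positivity) M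
  rw [div_le_iff₀ (by positivity), mul_pow] at h
  have h1 : (A + y) ^ M = (2 / κ) ^ M * ((κ / 2) ^ M * (A + y) ^ M) := by
    have h0 : 2 / κ * (κ / 2) = 1 := by field_simp
    rw [← mul_assoc, ← mul_pow, h0, one_pow, one_mul]
  have h2 : Real.exp (κ / 2 * (A + y)) * Real.exp (-(κ * y)) =
      Real.exp (κ / 2 * A) * Real.exp (-(κ / 2 * y)) := by
    rw [← Real.exp_add, ← Real.exp_add]; ring_nf
  calc _ = (2 / κ) ^ M * ((κ / 2) ^ M * (A + y) ^ M) * Real.exp (-(κ * y)) := by rw [← h1]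
    _ ≤ (2 / κ) ^ M * (Real.exp (κ / 2 * (A + y)) * M.factorial) * Real.exp (-(κ * y)) := by
      gcongr
    _ = (2 / κ) ^ M * M.factorial * (Real.exp (κ / 2 * (A + y)) * Real.exp (-(κ * y))) := by ring
    _ = _ := by rw [h2]; ring

lemma summable_exp_neg_abs_int {κ : ℝ} (hκ : 0 < κ) :
    Summable fun m : ℤ => Real.exp (-(κ * |(m : ℝ)|)) := by
  have h : Summable fun m : ℕ => Real.exp (-(κ * |(m : ℝ)|)) := by
    simpa [mul_comm] using Real.summable_exp_nat_mul_of_ge (neg_lt_zero.2 hκ) (f := fun m => m)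
      fun m => le_rfl
  exact Summable.of_nat_of_neg (by simpa using h) (by simpa using h)

lemma summable_pow_mul_exp (M : ℕ) {A κ : ℝ} (hκ : 0 < κ) (hA : 0 ≤ A) :
    Summable fun m : ℤ => (A + |(m : ℝ)|) ^ M * Real.exp (-(κ * |(m : ℝ)|)) :=
  .of_nonneg_of_le (fun _ => by positivity)
    (fun m => pow_mul_exp_le M hκ hA (abs_nonneg (m : ℝ)))
    ((summable_exp_neg_abs_int (half_pos hκ)).mul_left _)

lemma shift_weight_le {κ R t : ℝ} (hκ : 0 < κ) (ht : |t| ≤ R) (M : ℕ) (m : ℤ) :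
    ((1 + κ) * (1 + |t + m|)) ^ M * Real.exp (-(κ * |t + m|)) ≤
      (1 + κ) ^ M * Real.exp (κ * R) *
        ((1 + R + |(m : ℝ)|) ^ M * Real.exp (-(κ * |(m : ℝ)|))) := by
  have hR : 0 ≤ R := (abs_nonneg t).trans ht
  have h1 : 1 + |t + m| ≤ 1 + R + |(m : ℝ)| := by linarith [abs_add_le t m]
  have h2 : |(m : ℝ)| ≤ |t + m| + R := by
    have := abs_sub_abs_le_abs_sub (m : ℝ) (-t)
    rw [abs_neg, sub_neg_eq_add, add_comm (m : ℝ)] at this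
    linarith
  have h3 : Real.exp (-(κ * |t + m|)) ≤ Real.exp (κ * R) * Real.exp (-(κ * |(m : ℝ)|)) := by
    rw [← Real.exp_add]
    apply Real.exp_le_exp.2
    nlinarith
  rw [mul_pow]
  calc _ ≤ (1 + κ) ^ M * (1 + R + |(m : ℝ)|) ^ M *
        (Real.exp (κ * R) * Real.exp (-(κ * |(m : ℝ)|))) := by
        gcongr
    _ = _ := by ring

/-- Weighted periodizations of `psi`: the sum over those `m` for which `q` does not vanish decays
like `e^{-κ ω}` if `ω` is a lower bound for `|t + m|`. -/
lemma smoothBdd_psi_tsum (hκ₀ : 0 < κ₀) (ha : (n : ℝ) ≤ 2 * a) (hp : p = 0 ∨ (n : ℝ) < p)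
    {q : Idx κ₀ × ℤ → ℂ} (hq : ∀ j, ‖q j‖ ≤ 2) {S : Set ℝ} {ω : ℝ → ℝ}
    (hS : ∀ t ∈ S, |t| ≤ 1)
    (hω : ∀ i m, q (i, m) ≠ 0 → ∀ t ∈ S, ω t + max (|(m : ℝ)| - 1) 0 ≤ |t + m|) :
    SmoothBdd S (fun (i : Idx κ₀) _ => 1 + (i.1 : ℝ)) (fun i t => Real.exp (-((i.1 : ℝ) * ω t))) n
      (fun i t => ∑' m : ℤ, q (i, m) * (psi a p i.1 (t + m) : ℂ)) := by
  have hκ : ∀ i : Idx κ₀, 0 < (i.1 : ℝ) := fun i => hκ₀.trans_le i.1.2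
  refine (smoothBdd_psi_shift hκ₀ ha hp q).tsum (fun M i R => ?_) (fun M => ?_)
  · refine ⟨fun m => (1 + (i.1 : ℝ)) ^ M * Real.exp (i.1 * |R|) *
        ((1 + |R| + |(m : ℝ)|) ^ M * Real.exp (-(i.1 * |(m : ℝ)|))) * 2,
      ((summable_pow_mul_exp M (hκ i) (by positivity)).mul_left _).mul_right _, fun m t ht => ?_⟩
    have ht' : |t| ≤ |R| := by
      rw [Metric.mem_ball, Real.dist_eq, sub_zero] at ht
      exact ht.le.trans (le_abs_self R)
    simp only
    rw [← mul_assoc]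
    exact mul_le_mul (shift_weight_le (hκ i) ht' M m) (hq _) (norm_nonneg _)
      (by have := hκ i; positivity)
  -- The sum over `m` uses the rate `κ₀` instead of `κ`, which makes the constant independent of
  -- `κ`. The decay `e^{-κ ω}` is kept whole, and `e^{κ₀}` compensates for the `-1` in `|m| - 1`.
  · refine ⟨2 * Real.exp κ₀ *
      ∑' m : ℤ, (2 + |(m : ℝ)|) ^ M * Real.exp (-(κ₀ * |(m : ℝ)|)), M,
      mul_nonneg (by positivity) (tsum_nonneg fun _ => by positivity), fun i t ht => ?_⟩
    refine ⟨fun m => 2 * Real.exp κ₀ * (1 + (i.1 : ℝ)) ^ M * Real.exp (-(i.1 * ω t)) *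
      ((2 + |(m : ℝ)|) ^ M * Real.exp (-(κ₀ * |(m : ℝ)|))), fun m => ?_,
      (summable_pow_mul_exp M hκ₀ (by norm_num)).mul_left _, ?_⟩
    · have hi := hκ i
      simp only
      rcases eq_or_ne (q (i, m)) 0 with h0 | h0
      · rw [h0, norm_zero, mul_zero, mul_zero]
        positivity
      · have h1 : 1 + |t + m| ≤ 2 + |(m : ℝ)| := by linarith [abs_add_le t m, hS t ht]
        have h2 := hω i m h0 t ht
        have h3 : Real.exp (-(i.1 * |t + m|)) ≤
            Real.exp (-(i.1 * ω t)) * (Real.exp κ₀ * Real.exp (-(κ₀ * |(m : ℝ)|))) := by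
          rw [← Real.exp_add, ← Real.exp_add]
          apply Real.exp_le_exp.2
          have h4 : κ₀ ≤ (i.1 : ℝ) := i.1.2
          have h5 := mul_le_mul_of_nonneg_left h2 hi.le
          have h6 := mul_le_mul_of_nonneg_right h4 (le_max_right (|(m : ℝ)| - 1) 0)
          have h7 := mul_le_mul_of_nonneg_left (le_max_left (|(m : ℝ)| - 1) 0) hκ₀.le
          linarith
        rw [mul_pow]
        calc _ ≤ (1 + (i.1 : ℝ)) ^ M * (2 + |(m : ℝ)|) ^ M *
              ((Real.exp (-(i.1 * ω t)) * (Real.exp κ₀ * Real.exp (-(κ₀ * |(m : ℝ)|)))) * 2) := by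
              gcongr
              exact hq _
          _ = _ := by ring
    · rw [tsum_mul_left]
      exact le_of_eq (by ring)

lemma continuous_psi (ha : 0 ≤ a) (hp : 0 ≤ p) (κ : ℝ) : Continuous (psi a p κ) :=
  ((Real.continuous_sinc.comp (by fun_prop)).abs.rpow_const fun _ => Or.inr hp).mul
    ((continuous_kernel ha).comp (by fun_prop))

lemma kernel_pos (ha : 0 ≤ a) (t : ℝ) : 0 < kernel a t :=
  (mul_pos (Real.Gamma_pos_of_pos (by linarith)) (Real.exp_pos _)).trans_le (le_kernel ha t)

lemma psi_nonneg (ha : 0 ≤ a) (κ s : ℝ) : 0 ≤ psi a p κ s :=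
  mul_nonneg (Real.rpow_nonneg (abs_nonneg _) _) (kernel_pos ha _).le

/-- Jordan's inequality gives `sin (πt) ≥ 2t` for `0 ≤ t ≤ 1/2`, and `π ≤ 4`. -/
lemma half_le_sinc {t : ℝ} (ht : |t| ≤ 1 / 2) : 1 / 2 ≤ Real.sinc (Real.pi * t) := by
  wlog h : 0 ≤ t generalizing t
  · have := this (t := -t) (by rwa [abs_neg]) (by linarith)
    rwa [mul_neg, Real.sinc_neg] at this
  rw [abs_of_nonneg h] at ht
  rcases h.eq_or_lt with rfl | h0
  · norm_num
  · have hpi := Real.pi_pos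
    have hs := Real.mul_le_sin (x := Real.pi * t) (by positivity) (by nlinarith)
    rw [Real.sinc_of_ne_zero (by positivity), le_div_iff₀ (by positivity)]
    have h4 := Real.pi_le_four
    have : 2 / Real.pi * (Real.pi * t) = 2 * t := by field_simp
    nlinarith

lemma le_psi (ha : 0 ≤ a) (hp : 0 ≤ p) {κ t : ℝ} (hκ : 0 < κ) (ht : |t| ≤ 1 / 2) :
    (1 / 2) ^ p * Real.Gamma (2 * a + 1) * Real.exp (-(κ * |t|)) ≤ psi a p κ t := by
  have h1 := le_kernel ha (κ * t)
  have h2 := half_le_sinc ht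
  have h3 : 0 < Real.Gamma (2 * a + 1) := Real.Gamma_pos_of_pos (by linarith)
  rw [abs_mul, abs_of_pos hκ] at h1
  rw [psi, mul_assoc]
  gcongr
  exact h2.trans (le_abs_self _)

lemma exists_psi_shift_le (ha : 0 ≤ a) (hp : 0 ≤ p) {κ : ℝ} (hκ : 0 < κ) (R : ℝ) :
    ∃ u : ℤ → ℝ, Summable u ∧ ∀ m : ℤ, ∀ t : ℝ, |t| ≤ R → |psi a p κ (t + m)| ≤ u m := by
  obtain ⟨C, M, hC, h⟩ := (smoothBdd_kernel 0 (b := a) (by simpa using ha)).polyBdd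
  refine ⟨fun m => C * ((1 + κ) ^ M * Real.exp (κ * R) *
        ((1 + |R| + |(m : ℝ)|) ^ M * Real.exp (-(κ * |(m : ℝ)|)))),
      ((summable_pow_mul_exp M hκ (by positivity)).mul_left _).mul_left _, fun m t ht => ?_⟩
  have hR : |R| = R := abs_of_nonneg ((abs_nonneg t).trans ht)
  rw [hR]
  have h1 : |Real.sinc (Real.pi * (t + m))| ^ p ≤ 1 :=
    Real.rpow_le_one (abs_nonneg _) (abs_le.2 ⟨Real.neg_one_le_sinc _, Real.sinc_le_one _⟩) hp
  have h2 : |kernel a (κ * (t + m))| ≤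
      C * (1 + |κ * (t + m)|) ^ M * Real.exp (-|κ * (t + m)|) := h () (κ * (t + m)) trivial
  rw [abs_mul κ, abs_of_pos hκ] at h2
  have h3 := shift_weight_le hκ ht M m
  have h4 : (1 + κ * |t + m|) ^ M ≤ ((1 + κ) * (1 + |t + m|)) ^ M := by
    gcongr
    nlinarith [abs_nonneg (t + m)]
  rw [psi, abs_mul, abs_of_nonneg (Real.rpow_nonneg (abs_nonneg _) _)]
  calc _ ≤ 1 * (C * (1 + κ * |t + m|) ^ M * Real.exp (-(κ * |t + m|))) := by gcongr
    _ ≤ C * (((1 + κ) * (1 + |t + m|)) ^ M * Real.exp (-(κ * |t + m|))) := by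
      rw [one_mul, mul_assoc]
      gcongr
    _ ≤ _ := mul_le_mul_of_nonneg_left h3 hC

lemma summable_psi (ha : 0 ≤ a) (hp : 0 ≤ p) {κ : ℝ} (hκ : 0 < κ) (t : ℝ) :
    Summable fun m : ℤ => psi a p κ (t + m) := by
  obtain ⟨u, hu, h⟩ := exists_psi_shift_le ha hp hκ |t|
  exact .of_norm_bounded hu fun m => h m t le_rfl

lemma psi_le_psiSum (ha : 0 ≤ a) (hp : 0 ≤ p) {κ : ℝ} (hκ : 0 < κ) (t : ℝ) (m : ℤ) :
    psi a p κ (t + m) ≤ psiSum a p κ t :=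
  (summable_psi ha hp hκ t).le_tsum m fun _ _ => psi_nonneg ha _ _

lemma psiSum_add_int (κ t : ℝ) (m : ℤ) : psiSum a p κ (t + m) = psiSum a p κ t := by
  rw [psiSum, psiSum, ← (Equiv.addLeft m).tsum_eq (fun j : ℤ => psi a p κ (t + j))]
  simp [add_assoc]

/-- The term whose argument lies nearest to 0 has `|t + m| ≤ 1/2` and already suffices. -/
lemma le_psiSum (ha : 0 ≤ a) (hp : 0 ≤ p) {κ : ℝ} (hκ : 0 < κ) (t : ℝ) :
    (1 / 2) ^ p * Real.Gamma (2 * a + 1) * Real.exp (-(κ / 2)) ≤ psiSum a p κ t := by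
  have h1 : |t + (-round t : ℤ)| ≤ 1 / 2 := by
    push_cast
    exact abs_sub_round t
  refine le_trans ?_ (psi_le_psiSum ha hp hκ t (-round t))
  refine le_trans ?_ (le_psi ha hp hκ h1)
  have h3 : 0 < Real.Gamma (2 * a + 1) := Real.Gamma_pos_of_pos (by linarith)
  gcongr
  nlinarith

lemma psiSum_pos (ha : 0 ≤ a) (hp : 0 ≤ p) {κ : ℝ} (hκ : 0 < κ) (t : ℝ) :
    0 < psiSum a p κ t :=
  lt_of_lt_of_le (mul_pos (mul_pos (by positivity) (Real.Gamma_pos_of_pos (by linarith)))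
    (Real.exp_pos _)) (le_psiSum ha hp hκ t)

/-- The error term `(∑_m ψ(t + m) (e^{2πimx} - 1)) / ∑_m ψ(t + m)`. -/
def errorTerm (a p κ x t : ℝ) : ℂ :=
  (∑' m : ℤ, (Complex.exp (2 * Real.pi * Complex.I * m * x) - 1) * (psi a p κ (t + m) : ℂ)) *
    (psiSum a p κ t : ℂ)⁻¹

lemma norm_exp_two_pi_mul (x y : ℝ) : ‖Complex.exp (2 * Real.pi * Complex.I * x * y)‖ = 1 := by
  rw [show (2 * Real.pi * Complex.I * x * y : ℂ) = ((2 * Real.pi * x * y : ℝ) : ℂ) * Complex.I by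
    push_cast; ring]
  exact Complex.norm_exp_ofReal_mul_I _

/-- The heart of the estimate. The constants do not depend on the shift `x`, because it enters only
through the coefficients `e^{2πimx} - 1`, of modulus at most 2. -/
lemma smoothBdd_errorTerm (hκ₀ : 0 < κ₀) (ha0 : 0 ≤ a) (ha : (n : ℝ) ≤ 2 * a)
    (hp : p = 0 ∨ (n : ℝ) < p) {ε : ℝ} (hε : 0 < ε) :
    SmoothBdd {t | |t| ≤ (1 - ε) / 2} (fun (i : Idx κ₀) _ => 1 + (i.1 : ℝ))
      (fun i _ => Real.exp (-(i.1 * ε))) n (fun i t => errorTerm a p i.1 i.2 t) := by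
  have hκ : ∀ i : Idx κ₀, 0 < (i.1 : ℝ) := fun i => hκ₀.trans_le i.1.2
  have hp0 : 0 ≤ p := by
    rcases hp with rfl | hp
    · exact le_rfl
    · exact (Nat.cast_nonneg n).trans hp.le
  have hρ : ∀ (i : Idx κ₀) (_ : ℝ), 1 ≤ 1 + (i.1 : ℝ) := fun i _ => by linarith [hκ i]
  have hS : ∀ t ∈ {t : ℝ | |t| ≤ (1 - ε) / 2}, |t| ≤ 1 / 2 := fun t ht => by
    have : |t| ≤ (1 - ε) / 2 := ht
    linarith
  have hint : ∀ m : ℤ, m ≠ 0 → 1 ≤ |(m : ℝ)| := fun m hm => by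
    exact_mod_cast Int.one_le_abs hm
  have htri : ∀ (t : ℝ) (m : ℤ), |(m : ℝ)| - |t| ≤ |t + m| := fun t m => by
    have := abs_sub_abs_le_abs_sub (m : ℝ) (-t)
    rwa [abs_neg, sub_neg_eq_add, add_comm (m : ℝ)] at this
  -- Numerator: the coefficient at `m = 0` vanishes, and `|t + m| ≥ 1 - |t| + (|m| - 1)` for the
  -- others.
  have hB := smoothBdd_psi_tsum (n := n) hκ₀ ha hp
    (q := fun j => Complex.exp (2 * Real.pi * Complex.I * j.2 * j.1.2) - 1) (fun j => by
      refine (norm_sub_le _ _).trans ?_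
      have := norm_exp_two_pi_mul j.2 j.1.2
      push_cast at this
      rw [this, norm_one]
      norm_num) (S := {t | |t| ≤ (1 - ε) / 2}) (ω := fun t => 1 - |t|)
      (fun t ht => (hS t ht).trans (by norm_num)) (fun i m hm t ht => by
        have hm0 : m ≠ 0 := by
          rintro rfl
          simp at hm
        have h1 := hint m hm0
        rw [max_eq_left (by linarith)]
        linarith [htri t m])
  -- Denominator: here `m = 0` dominates, since `|m| - |t| ≥ |t| + (|m| - 1)` when `|t| ≤ 1/2`.
  have hD := smoothBdd_psi_tsum (n := n) hκ₀ ha hp (q := fun _ => 1) (fun _ => by norm_num)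
      (S := {t | |t| ≤ (1 - ε) / 2}) (ω := fun t => |t|)
      (fun t ht => (hS t ht).trans (by norm_num)) (fun i m _ t ht => by
        rcases eq_or_ne m 0 with rfl | hm0
        · simp
        have h1 := hint m hm0
        rw [max_eq_left (by linarith)]
        linarith [htri t m, hS t ht])
  have hDeq : (fun (i : Idx κ₀) (t : ℝ) => ∑' m : ℤ, 1 * (psi a p i.1 (t + m) : ℂ)) =
      fun i t => (psiSum a p i.1 t : ℂ) := by
    ext i t
    simp only [one_mul, psiSum]
    rw [Complex.ofReal_tsum]
  rw [hDeq] at hD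
  have hc : 0 < (1 / 2) ^ p * Real.Gamma (2 * a + 1) :=
    mul_pos (by positivity) (Real.Gamma_pos_of_pos (by linarith))
  have hDi := hD.inv hρ (fun _ _ => Real.exp_pos _)
    (fun i t => Complex.ofReal_ne_zero.2 (psiSum_pos ha0 hp0 (hκ i) t).ne')
    ⟨((1 / 2) ^ p * Real.Gamma (2 * a + 1))⁻¹, 0, (inv_pos.2 hc).le, fun i t ht => by
      rw [pow_zero, mul_one, ← div_eq_inv_mul, le_div_iff₀ hc, mul_comm, Complex.norm_real,
        Real.norm_of_nonneg (psiSum_pos ha0 hp0 (hκ i) t).le]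
      exact (le_psi ha0 hp0 (hκ i) (hS t ht)).trans
        (by simpa using psi_le_psiSum ha0 hp0 (hκ i) t 0)⟩
  refine (hB.mul hρ (fun _ _ => (Real.exp_pos _).le)
    (fun _ _ => (inv_pos.2 (Real.exp_pos _)).le) hDi).weaken subset_rfl hρ fun M =>
    ⟨1, M, zero_le_one, fun i t ht => ?_⟩
  have h1 : |t| ≤ (1 - ε) / 2 := ht
  have hi := hκ i
  rw [one_mul]
  gcongr
  -- The exponents combine to `-κ(1 - 2|t|)`, and `1 - 2|t| ≥ ε` on the set considered.
  rw [← Real.exp_neg, ← Real.exp_add]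
  apply Real.exp_le_exp.2
  nlinarith

end Periodization

/-! ### From the Bessel function to the kernel -/

section Bessel

/-- Substitute `u = 1 + s/r`, so that `r²(u² - 1) = s (s + 2r)`. -/
lemma integral_Ioi_one_eq_kernel (b : ℝ) {r : ℝ} (hr : 0 < r) :
    ∫ u in Set.Ioi (1 : ℝ), Real.exp (-(r * u)) * (u ^ 2 - 1) ^ b =
      r ^ (-(2 * b + 1)) * kernel b r := by
  have h1 : ∫ u in Set.Ioi (1 : ℝ), Real.exp (-(r * u)) * (u ^ 2 - 1) ^ b =
      ∫ s in Set.Ioi (0 : ℝ), Real.exp (-(r * (s + 1))) * ((s + 1) ^ 2 - 1) ^ b := by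
    have h := (measurePreserving_add_right volume (1 : ℝ)).setIntegral_preimage_emb
      (measurableEmbedding_addRight 1) (fun u => Real.exp (-(r * u)) * (u ^ 2 - 1) ^ b)
      (Set.Ioi 1)
    rw [← h]
    simp
  have h2 : ∀ s ∈ Set.Ioi (0 : ℝ), Real.exp (-(r * (s + 1))) * ((s + 1) ^ 2 - 1) ^ b =
      Real.exp (-r) * r ^ (-(2 * b)) *
        (Real.exp (-(r * s)) * ((r * s) * (r * s + 2 * r)) ^ b) := by
    intro s hs
    have hs : 0 < s := hs
    have h3 : (r * s) * (r * s + 2 * r) = r ^ 2 * ((s + 1) ^ 2 - 1) := by ring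
    have h4 : 0 ≤ (s + 1) ^ 2 - 1 := by nlinarith
    have h5 : r ^ (-(2 * b)) * r ^ (2 * b) = 1 := by
      rw [← Real.rpow_add hr, neg_add_cancel, Real.rpow_zero]
    have h7 : (r ^ 2) ^ b = r ^ (2 * b) := by
      rw [← Real.rpow_two, ← Real.rpow_mul hr.le]
    rw [h3, Real.mul_rpow (by positivity) h4, h7]
    have h6 : Real.exp (-(r * (s + 1))) = Real.exp (-r) * Real.exp (-(r * s)) := by
      rw [← Real.exp_add]; ring_nf
    rw [h6]
    linear_combination (-(Real.exp (-r) * Real.exp (-(r * s)) * ((s + 1) ^ 2 - 1) ^ b)) * h5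
  rw [h1, setIntegral_congr_fun measurableSet_Ioi h2, integral_const_mul,
    integral_comp_mul_left_Ioi (fun s => Real.exp (-s) * (s * (s + 2 * r)) ^ b) 0 hr, mul_zero,
    kernel, abs_of_pos hr, kernelInt, smul_eq_mul]
  have h7 : r ^ (-(2 * b + 1)) = r ^ (-(2 * b)) * r⁻¹ := by
    rw [← Real.rpow_neg_one r, ← Real.rpow_add hr]; ring_nf
  rw [h7]
  ring

lemma besselK_eq_kernel (ν : ℝ) {r : ℝ} (hr : 0 < r) :
    besselK ν r = Real.Gamma (1 / 2) / ((2 : ℝ) ^ |ν| * Real.Gamma (|ν| + 1 / 2)) *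
      (r ^ (-|ν|) * kernel (|ν| - 1 / 2) r) := by
  have h : r ^ (-(2 * (|ν| - 1 / 2) + 1)) = r ^ (-|ν|) * r ^ (-|ν|) := by
    rw [← Real.rpow_add hr]; ring_nf
  have h' : r ^ |ν| * r ^ (-|ν|) = 1 := by
    rw [← Real.rpow_add hr, add_neg_cancel, Real.rpow_zero]
  rw [besselK, integral_Ioi_one_eq_kernel _ hr, h]
  linear_combination (Real.Gamma (1 / 2) / ((2 : ℝ) ^ |ν| * Real.Gamma (|ν| + 1 / 2)) *
    r ^ (-|ν|) * kernel (|ν| - 1 / 2) r) * h'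

/-- The parameters `a`, `p` such that `phiHat α c ξ` is a constant multiple of
`|ξ|^{-p} kernel a (c ξ)`. -/
lemma exists_phiHat_eq {α : ℝ} {k : ℕ} (hk : Admissible α k) :
    ∃ a p : ℝ, 1 / 2 ≤ a ∧ ((k + 1 : ℕ) : ℝ) ≤ 2 * a ∧ (p = 0 ∨ ((k + 1 : ℕ) : ℝ) < p) ∧
      ∀ c : ℝ, 0 < c → ∃ A : ℝ, A ≠ 0 ∧ ∀ ξ : ℝ, ξ ≠ 0 →
        phiHat α c ξ = A * (|ξ| ^ (-p) * kernel a (c * ξ)) := by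
  have habs : ∀ {a c ξ : ℝ}, 0 < c → kernel a (c * |ξ|) = kernel a (c * ξ) := by
    intro a c ξ hc
    rcases abs_choice ξ with h | h
    · rw [h]
    · rw [h, mul_neg, kernel_neg]
  have hconst : ∀ ν : ℝ, 0 < Real.Gamma (1 / 2) / ((2 : ℝ) ^ |ν| * Real.Gamma (|ν| + 1 / 2)) :=
    fun ν => div_pos (Real.Gamma_pos_of_pos (by norm_num))
      (mul_pos (by positivity) (Real.Gamma_pos_of_pos (by positivity)))
  rcases hk with ⟨h1, h2, h3⟩ | ⟨h1, h2⟩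
  · have h4 : ((k : ℤ) : ℝ) ≤ 2 * α + 1 - 2 := by
      have h5 := Int.floor_le (2 * α + 1)
      have h6 : ((k : ℤ) : ℝ) ≤ (⌊2 * α + 1⌋ : ℝ) - 2 := by exact_mod_cast h3
      linarith
    push_cast at h4
    -- Admissibility gives `k ≤ 2α - 1`, which is exactly `k + 1 ≤ 2a`; then `k + 1 < p` follows.
    refine ⟨α, 2 * α + 1, h1, by push_cast; linarith, Or.inr (by push_cast; linarith),
      fun c hc => ?_⟩
    have hG : Real.Gamma (-α) ≠ 0 := Real.Gamma_ne_zero fun m hm => h2 m (by linarith)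
    refine ⟨(2 : ℝ) ^ (1 + α) / Real.Gamma (-α) * (Real.Gamma (1 / 2) /
      ((2 : ℝ) ^ |α + 1 / 2| * Real.Gamma (|α + 1 / 2| + 1 / 2))),
      mul_ne_zero (div_ne_zero (by positivity) hG) (hconst _).ne', fun ξ hξ => ?_⟩
    have hx : 0 < |ξ| := abs_pos.2 hξ
    rw [phiHat, besselK_eq_kernel _ (by positivity)]
    rw [abs_of_pos (by linarith : 0 < α + 1 / 2), add_sub_cancel_right, habs hc,
      Real.div_rpow hc.le hx.le, Real.mul_rpow hc.le hx.le, Real.rpow_neg hc.le,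
      Real.rpow_neg hx.le, Real.rpow_neg hx.le]
    have h5 : |ξ| ^ (2 * α + 1) = |ξ| ^ (α + 1 / 2) * |ξ| ^ (α + 1 / 2) := by
      rw [← Real.rpow_add hx]; ring_nf
    have hc' : c ^ (α + 1 / 2) ≠ 0 := (Real.rpow_pos_of_pos hc _).ne'
    have hx' : |ξ| ^ (α + 1 / 2) ≠ 0 := (Real.rpow_pos_of_pos hx _).ne'
    rw [h5]
    generalize c ^ (α + 1 / 2) = y at *
    generalize |ξ| ^ (α + 1 / 2) = z at *
    rw [mul_inv]
    field_simp
  · have hα : |α| = -α := abs_of_neg (by linarith)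
    have h4 : ((k : ℤ) : ℝ) < 2 * |α| - 2 + 1 - 2 := by
      have h5 := Int.ceil_lt_add_one (2 * |α| - 2)
      have h6 : ((k : ℤ) : ℝ) ≤ (⌈2 * |α| - 2⌉ : ℝ) - 2 := by exact_mod_cast h2
      linarith
    rw [hα] at h4
    push_cast at h4
    -- The Bessel order is now negative, so `|α + 1/2| = -(α + 1/2)`: the powers of `|ξ|` cancel,
    -- leaving `p = 0` and `a = |α + 1/2| - 1/2`.
    refine ⟨-α - 1, 0, by linarith, by push_cast; linarith, Or.inl rfl, fun c hc => ?_⟩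
    have hG : Real.Gamma (-α) ≠ 0 := (Real.Gamma_pos_of_pos (by linarith)).ne'
    refine ⟨(2 : ℝ) ^ (1 + α) / Real.Gamma (-α) * (Real.Gamma (1 / 2) /
      ((2 : ℝ) ^ |α + 1 / 2| * Real.Gamma (|α + 1 / 2| + 1 / 2))) * (c ^ (α + 1 / 2)) ^ 2,
      mul_ne_zero (mul_ne_zero (div_ne_zero (by positivity) hG) (hconst _).ne')
        (by positivity), fun ξ hξ => ?_⟩
    have hx : 0 < |ξ| := abs_pos.2 hξ
    have h5 : |α + 1 / 2| = -(α + 1 / 2) := abs_of_neg (by linarith)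
    rw [phiHat, besselK_eq_kernel _ (by positivity), h5]
    have h6 : -(α + 1 / 2) - 1 / 2 = -α - 1 := by ring
    rw [h6, habs hc, neg_neg, Real.div_rpow hc.le hx.le, Real.mul_rpow hc.le hx.le, neg_zero,
      Real.rpow_zero]
    have hx' : |ξ| ^ (α + 1 / 2) ≠ 0 := (Real.rpow_pos_of_pos hx _).ne'
    generalize c ^ (α + 1 / 2) = y at *
    generalize |ξ| ^ (α + 1 / 2) = z at *
    field_simp

lemma abs_sin_pi_add_int (s : ℝ) (j : ℤ) :
    |Real.sin (Real.pi * (s + j))| = |Real.sin (Real.pi * s)| := by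
  rw [mul_add, mul_comm Real.pi (j : ℝ), Real.sin_add_int_mul_pi, abs_mul]
  simp [abs_zpow]

/-- Off the integers, every translate of the transform is the same factor `A 2^(-p) |sin πs|^(-p)`
times a translate of `psi`; the factor cancels in the quotient. -/
lemma LHat_eq {α a p c A : ℝ} (hA : A ≠ 0)
    (h : ∀ ξ : ℝ, ξ ≠ 0 → phiHat α c ξ = A * (|ξ| ^ (-p) * kernel a (c * ξ)))
    {s : ℝ} (hs : ∀ j : ℤ, s ≠ j) :
    LHat α c (2 * Real.pi * s) =
      psi a p (2 * Real.pi * c) s / psiSum a p (2 * Real.pi * c) s := by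
  have hpi := Real.pi_pos
  have hsin : 0 < |Real.sin (Real.pi * s)| := by
    rw [abs_pos, Ne, Real.sin_eq_zero_iff]
    rintro ⟨n, hn⟩
    refine hs n (mul_left_cancel₀ hpi.ne' ?_)
    rw [← hn, mul_comm]
  have key : ∀ j : ℤ, phiHat α c (2 * Real.pi * s + 2 * Real.pi * j) =
      A * 2 ^ (-p) * |Real.sin (Real.pi * s)| ^ (-p) * psi a p (2 * Real.pi * c) (s + j) := by
    intro j
    have hsj : s + j ≠ 0 := fun h0 => hs (-j) (by push_cast; linarith)
    have hx : 0 < |s + j| := abs_pos.2 hsj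
    have h1 : 0 < Real.pi * |s + j| := by positivity
    rw [← mul_add, h _ (by positivity), psi, Real.sinc_of_ne_zero (by positivity), abs_div,
      abs_sin_pi_add_int, abs_mul, abs_mul, abs_mul, abs_of_pos hpi,
      abs_of_pos (by norm_num : (0 : ℝ) < 2), Real.div_rpow hsin.le h1.le, mul_assoc 2, Real.mul_rpow (by norm_num) h1.le,
      Real.rpow_neg hsin.le, Real.rpow_neg h1.le]
    have h2 : (|Real.sin (Real.pi * s)| ^ p)⁻¹ * |Real.sin (Real.pi * s)| ^ p = 1 :=
      inv_mul_cancel₀ (Real.rpow_pos_of_pos hsin _).ne'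
    have h3 : c * (2 * Real.pi * (s + j)) = 2 * Real.pi * c * (s + j) := by ring
    rw [h3]
    linear_combination (-(A * 2 ^ (-p) * ((Real.pi * |s + j|) ^ p)⁻¹ *
      kernel a (2 * Real.pi * c * (s + j)))) * h2
  have hC : A * 2 ^ (-p) * |Real.sin (Real.pi * s)| ^ (-p) ≠ 0 :=
    mul_ne_zero (mul_ne_zero hA (by positivity)) (by positivity)
  have h0 := key 0
  simp only [Int.cast_zero, mul_zero, add_zero] at h0
  rw [LHat, h0, tsum_congr key, tsum_mul_left, mul_div_mul_left _ _ hC, psiSum]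

end Bessel

/-! ### Fourier series of smooth functions of period 1 -/

section Fourier

/-- The `m`-th Fourier coefficient of a function of period `1`. -/
def perCoeff (F : ℝ → ℂ) (m : ℤ) : ℂ :=
  ∫ s in (0 : ℝ)..1, Complex.exp (-(2 * Real.pi * Complex.I * m * s)) * F s

/-- A continuous function of period `1` as a function on the circle. -/
def circleMap {F : ℝ → ℂ} (hF : Function.Periodic F 1) (hc : Continuous F) :
    C(UnitAddCircle, ℂ) :=
  ⟨hF.lift, continuous_coinduced_dom.mpr hc⟩

lemma fourierCoeff_lift {F : ℝ → ℂ} (hF : Function.Periodic F 1) (m : ℤ) :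
    fourierCoeff (T := (1 : ℝ)) hF.lift m = perCoeff F m := by
  rw [fourierCoeff_eq_intervalIntegral _ m 0, perCoeff, div_one, one_smul, zero_add]
  congr 1
  ext s
  rw [fourier_coe_apply, Function.Periodic.lift_coe, smul_eq_mul]
  congr 2
  push_cast
  ring

lemma hasDerivAt_exp_mul_ofReal (w : ℂ) (s : ℝ) :
    HasDerivAt (fun s : ℝ => Complex.exp (w * s)) (w * Complex.exp (w * s)) s := by
  have h := ((hasDerivAt_id (s : ℂ)).const_mul w).cexp.comp_ofReal
  refine h.congr_deriv ?_
  simp only [id]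
  ring

lemma perCoeff_deriv {F F' : ℝ → ℂ} (hF : Function.Periodic F 1)
    (hd : ∀ s, HasDerivAt F (F' s) s) (hc : Continuous F') (m : ℤ) :
    perCoeff F' m = 2 * Real.pi * Complex.I * m * perCoeff F m := by
  set w : ℂ := -(2 * Real.pi * Complex.I * m) with hw
  have hFc : Continuous F := continuous_iff_continuousAt.2 fun s => (hd s).continuousAt
  have hw1 : Complex.exp w = 1 := by
    rw [hw, Complex.exp_eq_one_iff]
    exact ⟨-m, by push_cast; ring⟩
  have h := intervalIntegral.integral_eq_sub_of_hasDerivAt (a := 0) (b := 1)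
    (fun s _ => (hasDerivAt_exp_mul_ofReal w s).mul (hd s))
    ((by fun_prop : Continuous fun s : ℝ =>
      w * Complex.exp (w * s) * F s + Complex.exp (w * s) * F' s).intervalIntegrable _ _)
  have h1 : F 1 = F 0 := by simpa using hF 0
  simp only [Complex.ofReal_one, Complex.ofReal_zero, mul_one, mul_zero, Complex.exp_zero, hw1, h1,
    sub_self, Pi.mul_apply] at h
  rw [intervalIntegral.integral_add
    ((by fun_prop : Continuous fun s : ℝ => w * Complex.exp (w * s) * F s).intervalIntegrable _ _)
    ((by fun_prop : Continuous fun s : ℝ => Complex.exp (w * s) * F' s).intervalIntegrable _ _)]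
    at h
  have h2 : ∫ s in (0 : ℝ)..1, w * Complex.exp (w * s) * F s = w * perCoeff F m := by
    rw [perCoeff, ← intervalIntegral.integral_const_mul]
    congr 1; ext s; rw [hw]; ring_nf
  have h3 : ∫ s in (0 : ℝ)..1, Complex.exp (w * s) * F' s = perCoeff F' m := by
    rw [perCoeff]
    congr 1; ext s; rw [hw]; ring_nf
  rw [h2, h3] at h
  rw [hw] at h
  linear_combination h

lemma summable_sq_perCoeff {F : ℝ → ℂ} (hF : Function.Periodic F 1) (hc : Continuous F) :
    Summable fun m => ‖perCoeff F m‖ ^ 2 := by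
  have h := (hasSum_sq_fourierCoeff (ContinuousMap.toLp (E := ℂ) 2
    (AddCircle.haarAddCircle (T := (1 : ℝ))) ℂ (circleMap hF hc))).summable
  refine h.congr fun m => ?_
  rw [fourierCoeff_toLp, ← fourierCoeff_lift hF]
  rfl

lemma periodic_of_hasDerivAt {F F' : ℝ → ℂ} (hF : Function.Periodic F 1)
    (hd : ∀ s, HasDerivAt F (F' s) s) : Function.Periodic F' 1 := by
  intro s
  have h := (hd (s + 1)).comp_add_const s 1
  rw [show (fun x => F (x + 1)) = F from funext hF] at h
  exact h.unique (hd s)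

/-- For `m ≠ 0` the coefficient of `F` is at most `|m|⁻¹` times that of `F'`. Both are square
summable, so the arithmetic-geometric inequality concludes. -/
lemma summable_perCoeff {F F' : ℝ → ℂ} (hF : Function.Periodic F 1)
    (hd : ∀ s, HasDerivAt F (F' s) s) (hc : Continuous F') : Summable (perCoeff F) := by
  have h1 := summable_sq_perCoeff (periodic_of_hasDerivAt hF hd) hc
  have h2 := Real.summable_one_div_int_pow.2 one_lt_two
  refine Summable.of_norm_bounded_eventually (h1.add h2) ?_
  filter_upwards [(Set.finite_singleton (0 : ℤ)).compl_mem_cofinite] with m hm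
  have hm0 : (m : ℝ) ≠ 0 := Int.cast_ne_zero.2 hm
  have h3 : ‖perCoeff F' m‖ = 2 * Real.pi * |(m : ℝ)| * ‖perCoeff F m‖ := by
    rw [perCoeff_deriv hF hd hc]
    simp [abs_of_pos Real.pi_pos]
  have h4 : 0 < |(m : ℝ)| := abs_pos.2 hm0
  have h5 : |(m : ℝ)| * ‖perCoeff F m‖ ≤ ‖perCoeff F' m‖ := by
    rw [h3, mul_assoc]
    exact le_mul_of_one_le_left (by positivity) (by linarith [Real.pi_gt_three])
  have h6 : ‖perCoeff F m‖ ≤ |(m : ℝ)|⁻¹ * ‖perCoeff F' m‖ := by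
    rw [← div_eq_inv_mul, le_div_iff₀ h4, mul_comm]
    exact h5
  have h7 : 1 / (m : ℝ) ^ 2 = |(m : ℝ)|⁻¹ ^ 2 := by rw [inv_pow, sq_abs, one_div]
  rw [h7]
  nlinarith [sq_nonneg (|(m : ℝ)|⁻¹ - ‖perCoeff F' m‖), sq_nonneg |(m : ℝ)|⁻¹,
    sq_nonneg ‖perCoeff F' m‖]

lemma hasSum_perCoeff {F : ℝ → ℂ} (hF : Function.Periodic F 1) (hc : Continuous F)
    (hs : Summable (perCoeff F)) (s : ℝ) :
    HasSum (fun m : ℤ => perCoeff F m * Complex.exp (2 * Real.pi * Complex.I * m * s)) (F s) := by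
  have hs' : Summable (fourierCoeff (circleMap hF hc)) :=
    hs.congr fun m => (fourierCoeff_lift hF m).symm
  have h := has_pointwise_sum_fourier_series_of_summable hs' (s : UnitAddCircle)
  have h1 : circleMap hF hc (s : UnitAddCircle) = F s := hF.lift_coe s
  rw [h1] at h
  refine h.congr_fun fun m => ?_
  rw [show fourierCoeff (circleMap hF hc) m = perCoeff F m from fourierCoeff_lift hF m,
    fourier_coe_apply, smul_eq_mul, Complex.ofReal_one, div_one]

lemma contDiff_iteratedDeriv_hasDerivAt {F : ℝ → ℂ} {n j : ℕ} (hc : ContDiff ℝ n F) (hj : j < n)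
    (s : ℝ) : HasDerivAt (iteratedDeriv j F) (iteratedDeriv (j + 1) F s) s := by
  rw [iteratedDeriv_succ]
  exact (hc.differentiable_iteratedDeriv j (by exact_mod_cast hj) s).hasDerivAt

lemma perCoeff_iteratedDeriv {F : ℝ → ℂ} (hF : Function.Periodic F 1) {n j : ℕ}
    (hc : ContDiff ℝ n F) (hj : j ≤ n) : Function.Periodic (iteratedDeriv j F) 1 ∧
      ∀ m, perCoeff (iteratedDeriv j F) m =
        (2 * Real.pi * Complex.I * m) ^ j * perCoeff F m := by
  induction j with
  | zero => simpa using hF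
  | succ j ih =>
    obtain ⟨h1, h2⟩ := ih (by omega)
    have hd := contDiff_iteratedDeriv_hasDerivAt hc (Nat.lt_of_succ_le hj)
    refine ⟨periodic_of_hasDerivAt h1 hd, fun m => ?_⟩
    rw [perCoeff_deriv h1 hd (hc.continuous_iteratedDeriv _ (by exact_mod_cast hj)), h2, pow_succ]
    ring

/-- The derivative of order `k + 1` is spent on absolute convergence of the series for order `k`. -/
lemma hasSum_iteratedDeriv {F : ℝ → ℂ} (hF : Function.Periodic F 1) {k : ℕ}
    (hc : ContDiff ℝ (k + 1 : ℕ) F) :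
    Summable (fun m : ℤ => (2 * Real.pi * Complex.I * m) ^ k * perCoeff F m) ∧
    ∀ s : ℝ, HasSum (fun m : ℤ => (2 * Real.pi * Complex.I * m) ^ k * perCoeff F m *
      Complex.exp (2 * Real.pi * Complex.I * m * s)) (iteratedDeriv k F s) := by
  obtain ⟨h1, h2⟩ := perCoeff_iteratedDeriv hF hc (Nat.le_succ k)
  have hd := contDiff_iteratedDeriv_hasDerivAt hc (Nat.lt_succ_self k)
  have hs := summable_perCoeff h1 hd (hc.continuous_iteratedDeriv _ le_rfl)
  simp only [← h2]
  exact ⟨hs, hasSum_perCoeff h1 (hc.continuous_iteratedDeriv _ (by exact_mod_cast Nat.le_succ k)) hs⟩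

lemma SmoothBdd.iteratedDeriv {ι : Type*} {S : Set ℝ} {ρ W : ι → ℝ → ℝ} {n : ℕ} (j : ℕ)
    {f : ι → ℝ → ℂ} (hf : SmoothBdd S ρ W (n + j) f) :
    SmoothBdd S ρ W n (fun i => iteratedDeriv j (f i)) := by
  induction j generalizing f with
  | zero => simpa using hf
  | succ j ih =>
    obtain ⟨-, g, hg, hgn⟩ := hf
    have h : ∀ i, deriv (f i) = g i := fun i => funext fun t => (hg i t).deriv
    simp only [iteratedDeriv_succ', h]
    exact ih hgn

lemma SmoothBdd.contDiff {ι : Type*} {S : Set ℝ} {ρ W : ι → ℝ → ℝ} {n : ℕ}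
    {f : ι → ℝ → ℂ} (hf : SmoothBdd S ρ W n f) (i : ι) : ContDiff ℝ n (f i) := by
  induction n generalizing f with
  | zero => simpa using hf.continuous i
  | succ n ih =>
    obtain ⟨-, g, hg, hgn⟩ := hf
    have h : deriv (f i) = g i := funext fun t => (hg i t).deriv
    push_cast
    refine contDiff_succ_iff_deriv.2 ⟨fun t => (hg i t).differentiableAt, by simp, ?_⟩
    rw [h]
    exact ih hgn

end Fourier

/-! ### The fundamental function as Fourier coefficients of a periodization -/

section Cardinal

variable {a p κ x : ℝ}

lemma continuous_psiSum (ha : 0 ≤ a) (hp : 0 ≤ p) (hκ : 0 < κ) : Continuous (psiSum a p κ) := by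
  refine continuous_iff_continuousAt.2 fun t => ?_
  obtain ⟨u, hu, h⟩ := exists_psi_shift_le ha hp hκ (|t| + 1)
  have hc : ContinuousOn (fun s => ∑' m : ℤ, psi a p κ (s + m)) (Metric.ball 0 (|t| + 1)) := by
    refine continuousOn_tsum (fun m => ((continuous_psi ha hp κ).comp
      (continuous_add_const (m : ℝ))).continuousOn) hu fun m y hy => h m y ?_
    rw [Metric.mem_ball, Real.dist_eq, sub_zero] at hy
    exact hy.le
  exact hc.continuousAt (Metric.isOpen_ball.mem_nhds (by simp))

/-- The Fourier transform of the fundamental function, modulated by `x` and rescaled. -/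
def modulated (a p κ x s : ℝ) : ℂ :=
  ((psi a p κ s / psiSum a p κ s : ℝ) : ℂ) * Complex.exp (2 * Real.pi * Complex.I * x * s)

/-- The periodization of `modulated`. -/
def periodized (a p κ x s : ℝ) : ℂ :=
  Complex.exp (2 * Real.pi * Complex.I * x * s) * (1 + errorTerm a p κ x s)

lemma norm_modulated (ha : 0 ≤ a) (hp : 0 ≤ p) (hκ : 0 < κ) (s : ℝ) :
    ‖modulated a p κ x s‖ = psi a p κ s / psiSum a p κ s := by
  rw [modulated, norm_mul, norm_exp_two_pi_mul, mul_one, Complex.norm_real, Real.norm_of_nonneg]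
  exact div_nonneg (psi_nonneg ha _ _) (psiSum_pos ha hp hκ s).le

lemma continuous_modulated (ha : 0 ≤ a) (hp : 0 ≤ p) (hκ : 0 < κ) :
    Continuous (modulated a p κ x) := by
  refine (Complex.continuous_ofReal.comp ((continuous_psi ha hp κ).div (continuous_psiSum ha hp hκ)
    fun s => (psiSum_pos ha hp hκ s).ne')).mul ?_
  fun_prop

lemma exists_modulated_shift_le (ha : 0 ≤ a) (hp : 0 ≤ p) (hκ : 0 < κ) (R : ℝ) :
    ∃ u : ℤ → ℝ, Summable u ∧ ∀ m : ℤ, ∀ t : ℝ, |t| ≤ R → ‖modulated a p κ x (t + m)‖ ≤ u m := by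
  obtain ⟨u, hu, h⟩ := exists_psi_shift_le ha hp hκ R
  have hc : 0 < (1 / 2) ^ p * Real.Gamma (2 * a + 1) * Real.exp (-(κ / 2)) :=
    mul_pos (mul_pos (by positivity) (Real.Gamma_pos_of_pos (by linarith))) (Real.exp_pos _)
  refine ⟨fun m => u m / ((1 / 2) ^ p * Real.Gamma (2 * a + 1) * Real.exp (-(κ / 2))),
    hu.div_const _, fun m t ht => ?_⟩
  rw [norm_modulated ha hp hκ]
  have h1 := (le_abs_self _).trans (h m t ht)
  exact div_le_div₀ ((psi_nonneg ha _ _).trans h1) h1 hc (le_psiSum ha hp hκ _)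

/-- All translates share the denominator `psiSum`, and `e^{2πix(s+m)}` factors. Subtracting 1 from
each `e^{2πimx}` removes exactly one copy of `psiSum / psiSum`. -/
lemma tsum_modulated (ha : 0 ≤ a) (hp : 0 ≤ p) (hκ : 0 < κ) (s : ℝ) :
    ∑' m : ℤ, modulated a p κ x (s + m) = periodized a p κ x s := by
  have hD : (psiSum a p κ s : ℂ) ≠ 0 := Complex.ofReal_ne_zero.2 (psiSum_pos ha hp hκ s).ne'
  have hs : Summable fun m : ℤ => (psi a p κ (s + m) : ℂ) :=
    Complex.summable_ofReal.2 (summable_psi ha hp hκ s)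
  have hs' : Summable fun m : ℤ =>
      Complex.exp (2 * Real.pi * Complex.I * m * x) * (psi a p κ (s + m) : ℂ) := by
    refine .of_norm_bounded hs.norm fun m => ?_
    have := norm_exp_two_pi_mul m x
    push_cast at this
    rw [norm_mul, this, one_mul]
  have h1 : ∀ m : ℤ, modulated a p κ x (s + m) =
      Complex.exp (2 * Real.pi * Complex.I * x * s) * (psiSum a p κ s : ℂ)⁻¹ *
        (Complex.exp (2 * Real.pi * Complex.I * m * x) * (psi a p κ (s + m) : ℂ)) := by
    intro m
    rw [modulated, psiSum_add_int]
    have : Complex.exp (2 * Real.pi * Complex.I * x * ((s + m : ℝ) : ℂ)) =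
        Complex.exp (2 * Real.pi * Complex.I * x * s) *
          Complex.exp (2 * Real.pi * Complex.I * m * x) := by
      rw [← Complex.exp_add]
      congr 1
      push_cast
      ring
    rw [this]
    push_cast
    ring
  rw [tsum_congr h1, tsum_mul_left, periodized, errorTerm]
  simp only [sub_mul, one_mul]
  rw [hs'.tsum_sub hs, ← Complex.ofReal_tsum, ← psiSum]
  field_simp
  ring

lemma periodic_periodized (ha : 0 ≤ a) (hp : 0 ≤ p) (hκ : 0 < κ) :
    Function.Periodic (periodized a p κ x) 1 := by
  intro s
  rw [← tsum_modulated ha hp hκ, ← tsum_modulated ha hp hκ,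
    ← (Equiv.addLeft (1 : ℤ)).tsum_eq (fun m : ℤ => modulated a p κ x (s + m))]
  simp [add_assoc]

/-- The unfolding half of Poisson summation: a Fourier coefficient of a periodization is a value of
the Fourier transform on the line. -/
lemma perCoeff_periodized (ha : 0 ≤ a) (hp : 0 ≤ p) (hκ : 0 < κ) (m : ℤ) :
    perCoeff (periodized a p κ x) m =
      ∫ s : ℝ, Complex.exp (-(2 * Real.pi * Complex.I * m * s)) * modulated a p κ x s := by
  let f : C(ℝ, ℂ) := ⟨modulated a p κ x, continuous_modulated ha hp hκ⟩
  have hf : ∀ K : TopologicalSpace.Compacts ℝ,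
      Summable fun n : ℤ => ‖(f.comp (ContinuousMap.addRight (n : ℝ))).restrict K‖ := by
    intro K
    obtain ⟨R, hR⟩ := K.isCompact.isBounded.subset_closedBall 0
    obtain ⟨u, hu, h⟩ := exists_modulated_shift_le (x := x) ha hp hκ |R|
    refine .of_nonneg_of_le (fun _ => norm_nonneg _) (fun n => ?_) hu
    have hu0 : 0 ≤ u n := (norm_nonneg _).trans (h n 0 (by simp))
    refine (ContinuousMap.norm_le _ hu0).2 fun y => h n y ?_
    have := hR y.2
    rw [Metric.mem_closedBall, Real.dist_eq, sub_zero] at this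
    exact this.trans (le_abs_self R)
  have hcoe : ∀ s : ℝ, (∑' n : ℤ, f.comp (ContinuousMap.addRight (n • (1 : ℝ)))) s =
      periodized a p κ x s := by
    intro s
    simp only [zsmul_one]
    rw [← ContinuousMap.tsum_apply (ContinuousMap.summable_of_locally_summable_norm hf),
      ← tsum_modulated ha hp hκ]
    rfl
  have h := Real.fourierCoeff_tsum_comp_add hf m
  rw [fourierCoeff_lift, Real.fourier_real_eq_integral_exp_smul] at h
  rw [show periodized a p κ x = _ from (funext hcoe).symm, h]
  congr 1
  ext s
  rw [smul_eq_mul]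
  congr 2
  push_cast
  ring

lemma fundamental_eq_perCoeff {α c A : ℝ} (ha : 0 ≤ a) (hp : 0 ≤ p) (hc : 0 < c) (hA : A ≠ 0)
    (h : ∀ ξ : ℝ, ξ ≠ 0 → phiHat α c ξ = A * (|ξ| ^ (-p) * kernel a (c * ξ))) (m : ℤ) :
    fundamental α c (x - m) = perCoeff (periodized a p (2 * Real.pi * c) x) m := by
  have hpi := Real.pi_pos
  have h1 := Measure.integral_comp_mul_left (fun ξ : ℝ => (LHat α c ξ : ℂ) *
    Complex.exp (Complex.I * ((x - m : ℝ) : ℂ) * (ξ : ℂ))) (2 * Real.pi)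
  rw [perCoeff_periodized ha hp (by positivity), fundamental]
  have h2 : ((2 * Real.pi : ℝ) : ℂ)⁻¹ * ∫ ξ : ℝ, (LHat α c ξ : ℂ) *
      Complex.exp (Complex.I * ((x - m : ℝ) : ℂ) * (ξ : ℂ)) =
      ∫ s : ℝ, (LHat α c (2 * Real.pi * s) : ℂ) *
        Complex.exp (Complex.I * ((x - m : ℝ) : ℂ) * ((2 * Real.pi * s : ℝ) : ℂ)) := by
    rw [h1, abs_of_pos (by positivity), Complex.real_smul, Complex.ofReal_inv]
  rw [h2]
  refine integral_congr_ae ?_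
  have hae : ∀ᵐ s : ℝ, s ∉ Set.range ((↑) : ℤ → ℝ) :=
    (Set.countable_range _).ae_notMem volume
  filter_upwards [hae] with s hs
  rw [LHat_eq hA h fun j hj => hs ⟨j, hj.symm⟩, modulated]
  have h3 : Complex.exp (Complex.I * ((x - m : ℝ) : ℂ) * ((2 * Real.pi * s : ℝ) : ℂ)) =
      Complex.exp (-(2 * Real.pi * Complex.I * m * s)) *
        Complex.exp (2 * Real.pi * Complex.I * x * s) := by
    rw [← Complex.exp_add]
    congr 1
    push_cast
    ring
  rw [h3]
  ring

end Cardinal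

/-! ### Derivative bounds for the modulated error term -/

section Modulation

lemma smoothBdd_exp_two_pi {S : Set ℝ} (n : ℕ) (q : ℂ) :
    SmoothBdd S (fun (_ : Unit) _ => 1) (fun _ _ => 1) n
      (fun _ t => q * Complex.exp (2 * Real.pi * Complex.I * t)) := by
  have key : ∀ q : ℂ, PolyBdd S (fun (_ : Unit) _ => 1) (fun _ _ => 1)
      (fun _ t => q * Complex.exp (2 * Real.pi * Complex.I * t)) := fun q =>
    ⟨‖q‖, 0, norm_nonneg q, fun _ t _ => by
      have := norm_exp_two_pi_mul 1 t
      rw [Complex.ofReal_one, mul_one] at this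
      rw [norm_mul, this]
      simp⟩
  induction n generalizing q with
  | zero => exact ⟨fun _ => by fun_prop, key q⟩
  | succ n ih =>
    refine ⟨key q, _, fun _ t => (hasDerivAt_exp_mul_ofReal _ t).const_mul q, ?_⟩
    simpa only [mul_assoc] using ih (q * (2 * Real.pi * Complex.I))

lemma iteratedDeriv_exp_mul_ofReal (k : ℕ) (w : ℂ) :
    iteratedDeriv k (fun s : ℝ => Complex.exp (w * s)) = fun s : ℝ => w ^ k * Complex.exp (w * s) := by
  induction k with
  | zero => simp
  | succ k ih =>
    rw [iteratedDeriv_succ, ih]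
    ext s
    rw [((hasDerivAt_exp_mul_ofReal w s).const_mul (w ^ k)).deriv]
    ring

variable {a p κ₀ ε : ℝ} {n : ℕ}

lemma smoothBdd_modulated_errorTerm (hκ₀ : 0 < κ₀) (ha0 : 0 ≤ a) (ha : (n : ℝ) ≤ 2 * a)
    (hp : p = 0 ∨ (n : ℝ) < p) (hε : 0 < ε) :
    SmoothBdd {t | |t| ≤ (1 - ε) / 2} (fun (i : Idx κ₀) _ => (1 + (i.1 : ℝ)) * (1 + |i.2|))
      (fun i _ => Real.exp (-(i.1 * ε))) n (fun i t =>
        Complex.exp (2 * Real.pi * Complex.I * i.2 * t) * errorTerm a p i.1 i.2 t) ∧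
    ∀ i : Idx κ₀, ContDiff ℝ n (fun t : ℝ => Complex.exp (2 * Real.pi * Complex.I * i.2 * t)) := by
  have hκ : ∀ i : Idx κ₀, 0 < (i.1 : ℝ) := fun i => hκ₀.trans_le i.1.2
  have hρ : ∀ (i : Idx κ₀) (_ : ℝ), 1 ≤ (1 + (i.1 : ℝ)) * (1 + |i.2|) := fun i _ => by
    nlinarith [hκ i, abs_nonneg i.2]
  have h1 := (smoothBdd_exp_two_pi (S := Set.univ) n 1).comp_affine (ι' := Idx κ₀)
    (S' := {t | |t| ≤ (1 - ε) / 2})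
    (ρ' := fun i _ => (1 + (i.1 : ℝ)) * (1 + |i.2|)) (W' := fun _ _ => 1)
    (fun _ => ()) (fun i : Idx κ₀ => i.2) (fun _ => 0) (fun _ => 1) (fun _ _ _ => trivial) hρ
    (fun _ => zero_le_one) ⟨1, 1, zero_le_one, fun i t _ => by
      nlinarith [hκ i, abs_nonneg i.2, mul_nonneg (hκ i).le (abs_nonneg i.2)]⟩
    (fun M => ⟨1, 0, by simp⟩) (fun _ => 1) ⟨1, 0, by simp⟩
  have h2 : (fun (i : Idx κ₀) (t : ℝ) => (1 : ℂ) * (1 * Complex.exp (2 * Real.pi * Complex.I *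
      ((i.2 * t + 0 : ℝ) : ℂ)))) =
      fun (i : Idx κ₀) (t : ℝ) => Complex.exp (2 * Real.pi * Complex.I * i.2 * t) := by
    ext i t
    push_cast
    ring_nf
  rw [h2] at h1
  have h3 := (smoothBdd_errorTerm (n := n) hκ₀ ha0 ha hp hε).weaken
    (ρ' := fun (i : Idx κ₀) _ => (1 + (i.1 : ℝ)) * (1 + |i.2|))
    (W' := fun (i : Idx κ₀) _ => Real.exp (-(i.1 * ε)))
    subset_rfl hρ fun M => ⟨1, M, zero_le_one, fun i t _ => by
      have := hκ i
      rw [one_mul]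
      gcongr
      nlinarith [abs_nonneg i.2]⟩
  exact ⟨(h1.mul hρ (fun _ _ => zero_le_one) (fun _ _ => (Real.exp_pos _).le) h3).congr
    fun i t => one_mul _, h1.contDiff⟩

lemma periodized_eq_add (a p κ x : ℝ) : periodized a p κ x =
    (fun t : ℝ => Complex.exp (2 * Real.pi * Complex.I * x * t)) +
      fun t : ℝ => Complex.exp (2 * Real.pi * Complex.I * x * t) * errorTerm a p κ x t := by
  ext t
  simp only [Pi.add_apply, periodized]
  ring

lemma contDiff_periodized {κ : ℝ} (hκ : 0 < κ) (ha0 : 0 ≤ a) (ha : (n : ℝ) ≤ 2 * a)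
    (hp : p = 0 ∨ (n : ℝ) < p) (x : ℝ) : ContDiff ℝ n (periodized a p κ x) := by
  -- Only smoothness is extracted, and `SmoothBdd` asserts it on the whole line whatever the set, so
  -- any `ε` would do; `κ` itself serves as lower bound `κ₀`.
  obtain ⟨h1, h2⟩ := smoothBdd_modulated_errorTerm (ε := 1) hκ ha0 ha hp one_pos
  rw [periodized_eq_add]
  exact (h2 (⟨κ, Set.self_mem_Ici⟩, x)).add (h1.contDiff (⟨κ, Set.self_mem_Ici⟩, x))

lemma norm_iteratedDeriv_periodized_sub_le {k : ℕ} (ha0 : 0 ≤ a)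
    (ha : ((k + 1 : ℕ) : ℝ) ≤ 2 * a) (hp : p = 0 ∨ ((k + 1 : ℕ) : ℝ) < p) (hε : 0 < ε) :
    ∃ C : ℝ, ∃ M : ℕ, 0 ≤ C ∧ ∀ κ : ℝ, 1 ≤ κ → ∀ x t : ℝ, |t| ≤ (1 - ε) / 2 →
      ‖iteratedDeriv k (periodized a p κ x) t -
        (2 * Real.pi * Complex.I * x) ^ k * Complex.exp (2 * Real.pi * Complex.I * x * t)‖ ≤
      C * ((1 + κ) * (1 + |x|)) ^ M * Real.exp (-(κ * ε)) := by
  obtain ⟨h1, h2⟩ := smoothBdd_modulated_errorTerm (κ₀ := 1) (n := k + 1) one_pos ha0 ha hp hε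
  rw [add_comm] at h1
  obtain ⟨C, M, hC, h⟩ := (h1.iteratedDeriv k).polyBdd
  refine ⟨C, M, hC, fun κ hκ x t ht => ?_⟩
  have h3 := (h1.contDiff (⟨κ, hκ⟩, x)).of_le (m := k) (by exact_mod_cast Nat.le_add_left k 1)
  have h4 := (h2 (⟨κ, hκ⟩, x)).of_le (m := k) (by exact_mod_cast Nat.le_succ k)
  rw [periodized_eq_add, iteratedDeriv_add h4.contDiffAt h3.contDiffAt,
    iteratedDeriv_exp_mul_ofReal, add_sub_cancel_left]
  exact h (⟨κ, hκ⟩, x) t ht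

/-- Without derivatives the modulation contributes a factor of modulus 1, so no power of `|x|`
appears. This is the source of uniformity on the line for `k = 0`. -/
lemma norm_periodized_sub_le (ha0 : 0 ≤ a) (hp : p = 0 ∨ 0 < p) (hε : 0 < ε) :
    ∃ C : ℝ, ∃ M : ℕ, 0 ≤ C ∧ ∀ κ : ℝ, 1 ≤ κ → ∀ x t : ℝ, |t| ≤ (1 - ε) / 2 →
      ‖periodized a p κ x t - Complex.exp (2 * Real.pi * Complex.I * x * t)‖ ≤
      C * (1 + κ) ^ M * Real.exp (-(κ * ε)) := by
  obtain ⟨C, M, hC, h⟩ := (smoothBdd_errorTerm (κ₀ := 1) (n := 0) one_pos ha0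
    (by simpa using ha0) (by simpa using hp) hε).polyBdd
  refine ⟨C, M, hC, fun κ hκ x t ht => ?_⟩
  rw [periodized, mul_add, mul_one, add_sub_cancel_left, norm_mul, norm_exp_two_pi_mul, one_mul]
  exact h (⟨κ, hκ⟩, x) t ht

end Modulation

/-! ### Integration against a complex measure on the circle -/

section Measure

instance isFiniteMeasure_variation {X : Type*} [MeasurableSpace X] (μ : ComplexMeasure X) :
    IsFiniteMeasure μ.variation := by
  have h : μ.variation ≤ (ComplexMeasure.re μ).totalVariation +
      (ComplexMeasure.im μ).totalVariation := by
    refine VectorMeasure.variation_le_of_forall_enorm_le fun E _ => ?_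
    have h1 : ‖μ E‖ₑ ≤ ‖(μ E).re‖ₑ + ‖(μ E).im‖ₑ := by
      rw [← ofReal_norm, ← ofReal_norm, ← ofReal_norm, ← ENNReal.ofReal_add (norm_nonneg _)
        (norm_nonneg _)]
      exact ENNReal.ofReal_le_ofReal (Complex.norm_le_abs_re_add_abs_im _)
    exact h1.trans (add_le_add
      (SignedMeasure.enorm_le_totalVariation (ComplexMeasure.re μ) E)
      (SignedMeasure.enorm_le_totalVariation (ComplexMeasure.im μ) E))
  exact isFiniteMeasure_of_le _ h

lemma measurable_rep : Measurable rep :=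
  have : Fact (0 < 2 * Real.pi) := ⟨Real.two_pi_pos⟩
  measurable_subtype_coe.comp (AddCircle.measurableEquivIco (2 * Real.pi) (-Real.pi)).measurable

/-- The pairing is only `ℝ`-bilinear by type, so complex homogeneity is checked on the set function
and passed to the integral. -/
lemma vectorIntegral_const_mul {X : Type*} [MeasurableSpace X] (μ : ComplexMeasure X) (q : ℂ)
    (f : X → ℂ) : VectorMeasure.integral μ (fun z => q * f z) (ContinuousLinearMap.mul ℝ ℂ) =
      q * VectorMeasure.integral μ f (ContinuousLinearMap.mul ℝ ℂ) := by
  have h := setToFun_smul (dominatedFinMeasAdditive_cbmApplyMeasure μ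
    (ContinuousLinearMap.mul ℝ ℂ)) (fun c s x => by
      change (ContinuousLinearMap.mul ℝ ℂ) (c • x) (μ s) =
        c • (ContinuousLinearMap.mul ℝ ℂ) x (μ s)
      simp [mul_assoc]) q f
  exact h

lemma periodIntegral_const_mul (μ : ComplexMeasure Circ) (q : ℂ) (g : ℝ → ℂ) :
    periodIntegral μ (fun t => q * g t) = q * periodIntegral μ g :=
  vectorIntegral_const_mul μ q _

lemma norm_periodIntegral_le (μ : ComplexMeasure Circ) {g : ℝ → ℂ} {S : Set ℝ}
    (hμ : ∀ z ∈ μ.variation.support, rep z ∈ S) {C : ℝ} (hg : ∀ t ∈ S, ‖g t‖ ≤ C) :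
    ‖periodIntegral μ g‖ ≤ C * ‖ContinuousLinearMap.mul ℝ ℂ‖ * μ.variation.real Set.univ := by
  refine VectorMeasure.norm_integral_le_of_norm_le_const ?_
  filter_upwards [Measure.support_mem_ae] with z hz using hg _ (hμ z hz)

lemma integrable_rep (μ : ComplexMeasure Circ) {g : ℝ → ℂ} (hg : Continuous g) :
    VectorMeasure.Integrable μ (fun z => g (rep z)) := by
  obtain ⟨C, hC⟩ := (isCompact_Icc (a := -Real.pi) (b := -Real.pi + 2 * Real.pi)
    ).exists_bound_of_continuousOn hg.continuousOn
  exact Integrable.of_bound (hg.measurable.comp measurable_rep).aestronglyMeasurable C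
    (ae_of_all _ fun z => hC _ (Set.Ico_subset_Icc_self
      (QuotientAddGroup.equivIcoMod Real.two_pi_pos (-Real.pi) z).2))

lemma hasSum_periodIntegral (μ : ComplexMeasure Circ) {F : ℤ → ℝ → ℂ} {g : ℝ → ℂ}
    (hF : ∀ m, Continuous (F m)) {u : ℤ → ℝ} (hu : Summable u) (hle : ∀ m t, ‖F m t‖ ≤ u m)
    (h : ∀ t, HasSum (fun m => F m t) (g t)) :
    HasSum (fun m => periodIntegral μ (F m)) (periodIntegral μ g) :=
  VectorMeasure.hasSum_integral_of_dominated_convergence (fun m _ => u m)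
    (fun m => ((hF m).measurable.comp measurable_rep).aestronglyMeasurable)
    (fun m => ae_of_all _ fun _ => hle m _) (ae_of_all _ fun _ => hu) (integrable_const _)
    (ae_of_all _ fun _ => h _)

end Measure

/-! ### The interpolation series as an integral, and its distance to the target -/

section Main

variable {α a p c A : ℝ} {k : ℕ} {μ : ComplexMeasure Circ}

lemma norm_exp_neg_I_mul (x t : ℝ) : ‖Complex.exp (-(Complex.I * x * t))‖ = 1 := by
  rw [show -(Complex.I * x * t) = ((-(x * t) : ℝ) : ℂ) * Complex.I by push_cast; ring]
  exact Complex.norm_exp_ofReal_mul_I _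

lemma two_pi_pow_mul_measureTransform (x : ℝ) :
    (2 * Real.pi : ℂ) ^ k * measureTransform k μ x =
      (2 * Real.pi * Complex.I * x) ^ k *
        periodIntegral μ (fun t => Complex.exp (-(Complex.I * x * t))) := by
  rw [measureTransform, ← mul_assoc, ← mul_pow]
  ring_nf

/-- At `s = -t/(2π)` the characters become `e^{-imt}`, whose integral against `μ` times `(2πim)^k`
is `(2π)^k f(m)`. Absolute summability of the coefficients permits integrating term by term. -/
lemma hasSum_interpolant (ha0 : 0 ≤ a) (ha : ((k + 1 : ℕ) : ℝ) ≤ 2 * a)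
    (hp : p = 0 ∨ ((k + 1 : ℕ) : ℝ) < p) (hc : 0 < c) (hA : A ≠ 0)
    (h : ∀ ξ : ℝ, ξ ≠ 0 → phiHat α c ξ = A * (|ξ| ^ (-p) * kernel a (c * ξ))) (x : ℝ) :
    HasSum (fun j : ℤ => (2 * Real.pi : ℂ) ^ k *
        (measureTransform k μ j * fundamental α c (x - j)))
      (periodIntegral μ fun t =>
        iteratedDeriv k (periodized a p (2 * Real.pi * c) x) (-t / (2 * Real.pi))) := by
  have hpi := Real.pi_pos
  have hp0 : 0 ≤ p := by
    rcases hp with rfl | hp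
    · exact le_rfl
    · exact (Nat.cast_nonneg _).trans hp.le
  have hκ : 0 < 2 * Real.pi * c := by positivity
  obtain ⟨hs, hS⟩ := hasSum_iteratedDeriv (periodic_periodized (x := x) ha0 hp0 hκ)
    (contDiff_periodized hκ ha0 ha hp x)
  set L := perCoeff (periodized a p (2 * Real.pi * c) x) with hL
  have h1 := hasSum_periodIntegral μ (F := fun (m : ℤ) t =>
      (2 * Real.pi * Complex.I * m) ^ k * L m * Complex.exp (-(Complex.I * (m : ℝ) * t)))
    (fun m => by fun_prop) hs.norm (fun m t => by rw [norm_mul, norm_exp_neg_I_mul, mul_one])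
    (fun t => by
      refine (hS (-t / (2 * Real.pi))).congr_fun fun m => ?_
      congr 2
      have : (Real.pi : ℂ) ≠ 0 := Complex.ofReal_ne_zero.2 hpi.ne'
      push_cast
      field_simp)
  refine h1.congr_fun fun m => ?_
  rw [fundamental_eq_perCoeff ha0 hp0 hc hA h, ← hL, periodIntegral_const_mul, ← mul_assoc,
    two_pi_pow_mul_measureTransform]
  push_cast
  ring

lemma summable_interpolant (ha0 : 0 ≤ a) (ha : ((k + 1 : ℕ) : ℝ) ≤ 2 * a)
    (hp : p = 0 ∨ ((k + 1 : ℕ) : ℝ) < p) (hc : 0 < c) (hA : A ≠ 0)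
    (h : ∀ ξ : ℝ, ξ ≠ 0 → phiHat α c ξ = A * (|ξ| ^ (-p) * kernel a (c * ξ))) (x : ℝ) :
    Summable (fun j : ℤ => measureTransform k μ j * fundamental α c (x - j)) := by
  have hpi : (2 * Real.pi : ℂ) ^ k ≠ 0 :=
    pow_ne_zero _ (mul_ne_zero two_ne_zero (Complex.ofReal_ne_zero.2 Real.pi_ne_zero))
  exact (summable_mul_left_iff hpi).1 (hasSum_interpolant ha0 ha hp hc hA h x).summable

lemma norm_interpolant_sub_le (ha0 : 0 ≤ a) (ha : ((k + 1 : ℕ) : ℝ) ≤ 2 * a)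
    (hp : p = 0 ∨ ((k + 1 : ℕ) : ℝ) < p) (hc : 0 < c) (hA : A ≠ 0)
    (h : ∀ ξ : ℝ, ξ ≠ 0 → phiHat α c ξ = A * (|ξ| ^ (-p) * kernel a (c * ξ))) {ε : ℝ}
    (hμ : ∀ z ∈ μ.variation.support, rep z ∈
      Set.Icc (-(Real.pi * (1 - ε))) (Real.pi * (1 - ε))) (x : ℝ) {B : ℝ}
    (hB : ∀ t : ℝ, |t| ≤ (1 - ε) / 2 →
      ‖iteratedDeriv k (periodized a p (2 * Real.pi * c) x) t -
        (2 * Real.pi * Complex.I * x) ^ k * Complex.exp (2 * Real.pi * Complex.I * x * t)‖ ≤ B) :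
    ‖interpolant α c (measureTransform k μ) x - measureTransform k μ x‖ ≤
      B * (‖ContinuousLinearMap.mul ℝ ℂ‖ * μ.variation.real Set.univ) := by
  have hpi := Real.pi_pos
  have hsum := hasSum_interpolant (μ := μ) ha0 ha hp hc hA h x
  have h1 := two_pi_pow_mul_measureTransform (k := k) (μ := μ) x
  rw [← periodIntegral_const_mul] at h1
  have hG : Continuous fun t : ℝ =>
      iteratedDeriv k (periodized a p (2 * Real.pi * c) x) (-t / (2 * Real.pi)) :=
    ((contDiff_periodized (by positivity) ha0 ha hp x).continuous_iteratedDeriv k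
      (by exact_mod_cast Nat.le_succ k)).comp (by fun_prop)
  have hE : Continuous fun t : ℝ =>
      (2 * Real.pi * Complex.I * x) ^ k * Complex.exp (-(Complex.I * x * t)) := by fun_prop
  have h2 : (2 * Real.pi : ℂ) ^ k *
      (interpolant α c (measureTransform k μ) x - measureTransform k μ x) =
      periodIntegral μ fun t =>
        iteratedDeriv k (periodized a p (2 * Real.pi * c) x) (-t / (2 * Real.pi)) -
          (2 * Real.pi * Complex.I * x) ^ k * Complex.exp (-(Complex.I * x * t)) := by
    rw [mul_sub, interpolant, ← tsum_mul_left, hsum.tsum_eq, h1]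
    exact (VectorMeasure.integral_fun_sub (integrable_rep μ hG) (integrable_rep μ hE)).symm
  have h3 := norm_periodIntegral_le μ hμ (C := B) (g := fun t =>
        iteratedDeriv k (periodized a p (2 * Real.pi * c) x) (-t / (2 * Real.pi)) -
          (2 * Real.pi * Complex.I * x) ^ k * Complex.exp (-(Complex.I * x * t))) fun t ht => ?_
  · rw [← h2, norm_mul, mul_assoc] at h3
    -- The factor `(2π)^k` is at least 1 and is simply discarded.
    refine le_trans (le_mul_of_one_le_left (norm_nonneg _) ?_) h3
    rw [norm_pow, norm_mul, Complex.norm_real, Real.norm_of_nonneg hpi.le, Complex.norm_two]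
    exact one_le_pow₀ (by linarith [Real.pi_gt_three])
  · have h4 := hB (-t / (2 * Real.pi)) (by
      rw [abs_div, abs_neg, abs_of_pos (by positivity : 0 < 2 * Real.pi),
        div_le_iff₀ (by positivity)]
      have := abs_le.2 ht
      linarith)
    convert h4 using 4
    have : (Real.pi : ℂ) ≠ 0 := Complex.ofReal_ne_zero.2 hpi.ne'
    push_cast
    field_simp

lemma tendsto_pow_mul_exp_neg (M : ℕ) {ε : ℝ} (hε : 0 < ε) :
    Tendsto (fun c : ℝ => (1 + 2 * Real.pi * c) ^ M * Real.exp (-(2 * Real.pi * c * ε)))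
      atTop (𝓝 0) := by
  have h1 : Tendsto (fun κ : ℝ => (1 + κ) ^ M * Real.exp (-(ε * κ))) atTop (𝓝 0) := by
    have h2 : Tendsto (fun κ : ℝ => (2 / ε) ^ M * M.factorial * Real.exp (ε / 2 * 1) *
        Real.exp (-(ε / 2 * κ))) atTop (𝓝 0) := by
      have h3 : Tendsto (fun κ : ℝ => Real.exp (-(ε / 2 * κ))) atTop (𝓝 0) :=
        Real.tendsto_exp_neg_atTop_nhds_zero.comp (tendsto_id.const_mul_atTop (half_pos hε))
      simpa using h3.const_mul ((2 / ε) ^ M * M.factorial * Real.exp (ε / 2 * 1))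
    refine squeeze_zero' ?_ ?_ h2
    · filter_upwards [eventually_ge_atTop 0] with κ hκ
      positivity
    · filter_upwards [eventually_ge_atTop 0] with κ hκ
      exact pow_mul_exp_le M hε zero_le_one hκ
  have h4 := h1.comp (tendsto_id.const_mul_atTop Real.two_pi_pos)
  refine h4.congr fun c => ?_
  simp only [Function.comp_apply, id]
  ring_nf

lemma tendstoUniformlyOn_of_norm_sub_le {G : ℝ → ℝ → ℂ} {f : ℝ → ℂ} {K : Set ℝ} {C : ℝ} {M : ℕ}
    {ε : ℝ} (hε : 0 < ε) (h : ∀ c : ℝ, 1 ≤ c → ∀ x ∈ K, ‖G c x - f x‖ ≤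
      C * ((1 + 2 * Real.pi * c) ^ M * Real.exp (-(2 * Real.pi * c * ε)))) :
    TendstoUniformlyOn G f atTop K := by
  have hlim := (tendsto_pow_mul_exp_neg M hε).const_mul C
  rw [mul_zero] at hlim
  rw [Metric.tendstoUniformlyOn_iff]
  intro δ hδ
  filter_upwards [hlim.eventually (gt_mem_nhds hδ), eventually_ge_atTop 1] with c h1 h2 x hx
  rw [dist_comm, dist_eq_norm]
  exact (h c h2 x hx).trans_lt h1

end Main

end Multiquadric

end

/-! ### The convergence theorem -/

theorem mainTheorem11 (α : ℝ) (k : ℕ) (hk : Multiquadric.Admissible α k)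
    (ε : ℝ) (hε₀ : 0 < ε) (hε₁ : ε < 1)
    (μ : ComplexMeasure Multiquadric.Circ)
    (hμ : ∀ z ∈ μ.variation.support, Multiquadric.rep z ∈
      Set.Icc (-(Real.pi * (1 - ε))) (Real.pi * (1 - ε)))
    (f : ℝ → ℂ) (hf : f = Multiquadric.measureTransform k μ) :
    -- the series defining the interpolant converges
    (∀ c : ℝ, 0 < c → ∀ x : ℝ,
      Summable fun j : ℤ => f (j : ℝ) * Multiquadric.fundamental α c (x - (j : ℝ))) ∧
    (∀ x : ℝ, Tendsto (fun c : ℝ => Multiquadric.interpolant α c f x) atTop (𝓝 (f x))) ∧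
    (∀ K : Set ℝ, IsCompact K →
      TendstoUniformlyOn (fun c : ℝ => Multiquadric.interpolant α c f) f atTop K) ∧
    (k = 0 →
      TendstoUniformly (fun c : ℝ => Multiquadric.interpolant α c f) f atTop) := by
  open Multiquadric in
  subst hf
  obtain ⟨a, p, ha₁, ha, hp, hA⟩ := exists_phiHat_eq hk
  have ha0 : 0 ≤ a := by linarith
  have hcompact : ∀ K : Set ℝ, IsCompact K →
      TendstoUniformlyOn (fun c : ℝ => interpolant α c (measureTransform k μ))
        (measureTransform k μ) atTop K := by
    intro K hK
    obtain ⟨R, hR⟩ := hK.isBounded.subset_closedBall 0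
    obtain ⟨C, M, hC, h⟩ := norm_iteratedDeriv_periodized_sub_le ha0 ha hp hε₀
    refine tendstoUniformlyOn_of_norm_sub_le (M := M) (C := C * (1 + R) ^ M *
      (‖ContinuousLinearMap.mul ℝ ℂ‖ * μ.variation.real Set.univ)) hε₀ fun c hc x hx => ?_
    obtain ⟨A, hA0, hA⟩ := hA c (by linarith)
    have hκ : 1 ≤ 2 * Real.pi * c := by nlinarith [Real.pi_gt_three]
    have hxR : |x| ≤ R := by simpa using hR hx
    refine (norm_interpolant_sub_le ha0 ha hp (by linarith) hA0 hA hμ x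
      fun t ht => h _ hκ x t ht).trans ?_
    have h1 : C * ((1 + 2 * Real.pi * c) * (1 + |x|)) ^ M * Real.exp (-(2 * Real.pi * c * ε)) ≤
        C * ((1 + 2 * Real.pi * c) * (1 + R)) ^ M * Real.exp (-(2 * Real.pi * c * ε)) := by
      gcongr
    refine (mul_le_mul_of_nonneg_right h1 (by positivity)).trans (le_of_eq ?_)
    rw [mul_pow]
    ring
  refine ⟨fun c hc x => ?_, fun x => ?_, hcompact, fun hk0 => ?_⟩
  · obtain ⟨A, hA0, hA⟩ := hA c hc
    exact summable_interpolant ha0 ha hp hc hA0 hA x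
  · exact (hcompact {x} isCompact_singleton).tendsto_at rfl
  · subst hk0
    have hp' : p = 0 ∨ 0 < p := hp.imp_right fun h => (Nat.cast_nonneg _).trans_lt h
    -- This bound carries no factor `1 + |x|`, in contrast to the one used on compact sets.
    obtain ⟨C, M, hC, h⟩ := norm_periodized_sub_le ha0 hp' hε₀
    rw [← tendstoUniformlyOn_univ]
    refine tendstoUniformlyOn_of_norm_sub_le (M := M) (C := C *
      (‖ContinuousLinearMap.mul ℝ ℂ‖ * μ.variation.real Set.univ)) hε₀ fun c hc x _ => ?_
    obtain ⟨A, hA0, hA⟩ := hA c (by linarith)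
    have hκ : 1 ≤ 2 * Real.pi * c := by nlinarith [Real.pi_gt_three]
    refine (norm_interpolant_sub_le
      (B := C * (1 + 2 * Real.pi * c) ^ M * Real.exp (-(2 * Real.pi * c * ε)))
      ha0 ha hp (by linarith) hA0 hA hμ x fun t ht => ?_).trans (le_of_eq ?_)
    · simpa using h _ hκ x t ht
    · ring
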